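/- Let $f\in\mathbb{R}[x,y,z]$ be a form that is hyperbolic with respect to $e\in\mathbb{R}^3$, i.e. $f$ is homogeneous, $f(e)\neq 0$, and for every $a\in\mathbb{R}^3$ all complex roots of $f(te+a)\in\mathbb{R}[t]$ are real. Suppose that the projective plane curve $\mathcal{V}_{\mathbb{C}}(f)\subset\mathbb{P}^2(\mathbb{C})$ has no real singular points (i.e. no real point of the curve at which all first partial derivatives of $f$ vanish). Let $g\in\mathbb{R}[x,y,z]$ be a form that interlaces $f$ with respect to $e$: $g$ is homogeneous of degree $\deg(f)-1$, and for every $a\in\mathbb{R}^3$ the polynomials $f(te+a)$ and $g(te+a)$ have degrees $d=\deg f$ and $d-1$ and only real roots $\alpha_1\le\dots\le\alpha_d$ and $\beta_1\le\dots\le\beta_{d-1}$ (counted with multiplicity), with $\alpha_i\le\beta_i\le\alpha_{i+1}$ for $i=1,\dots,d-1$. For $P\in\mathbb{P}^2(\mathbb{C})$ let $I_P(f,g)$ denote the intersection multiplicity of $f$ and $g$ at $P$, the complex dimension of the local ring of $\mathbb{P}^2$ at $P$ modulo the (dehomogenized) $f$ and $g$. Then: 1. If $f$ and $g$ have no common factor,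 then $\mathcal{V}_{\mathbb{C}}(g)$ is a curve of real contact of $\mathcal{V}_{\mathbb{C}}(f)$: there is a divisor $D=\sum_i n_iP_i$ ($n_i\in\mathbb{Z}$, $P_i\in\mathcal{V}_{\mathbb{C}}(f)$) such that the intersection divisor $f.g=\sum_{P\in\mathcal{V}_{\mathbb{C}}(f)\cap\mathcal{V}_{\mathbb{C}}(g)} I_P(f,g)\,P$ equals $D+\overline{D}$, where $\overline{D}=\sum_i n_i\overline{P_i}$. 2. Whether or not $f$ and $g$ have a common factor, at every real point $P$ of $\mathcal{V}_{\mathbb{C}}(f)\cap\mathcal{V}_{\mathbb{C}}(g)$ the multiplicity $I_P(f,g)$ is even or infinite. -/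

import Mathlib

namespace RealContact

open MvPolynomial

noncomputable section

/-! ### Hyperbolicity and interlacing -/

/-- The univariate polynomial `f(te + a)` in the variable `t`. -/
def restrictToLine {σ : Type*} (f : MvPolynomial σ ℝ) (e a : σ → ℝ) : Polynomial ℝ :=
  aeval (fun i => Polynomial.X * Polynomial.C (e i) + Polynomial.C (a i)) f

/-- A form `f` is hyperbolic with respect to `e` if `f(e) ≠ 0` and, for every real `a`, all
(complex) roots of `f(te + a)` are real. -/
def IsHyperbolic {σ : Type*} (f : MvPolynomial σ ℝ) (e : σ → ℝ) : Prop :=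
  (∃ d : ℕ, f.IsHomogeneous d) ∧ eval e f ≠ 0 ∧
    ∀ (a : σ → ℝ) (z : ℂ), Polynomial.aeval z (restrictToLine f e a) = 0 → z.im = 0

/-- `q` interlaces `p`: they have degrees `d` and `d + 1` (for some `d ≥ 0`) and only real zeros
`β₀ ≤ … ≤ β_{d-1}` and `α₀ ≤ … ≤ α_d` (with multiplicities), and `α_i ≤ β_i ≤ α_{i+1}`. -/
def UnivInterlaces (q p : Polynomial ℝ) : Prop :=
  ∃ (d : ℕ) (α : Fin (d + 1) → ℝ) (β : Fin d → ℝ) (b c : ℝ),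
    b ≠ 0 ∧ c ≠ 0 ∧
    p = Polynomial.C c * ∏ i, (Polynomial.X - Polynomial.C (α i)) ∧
    q = Polynomial.C b * ∏ i, (Polynomial.X - Polynomial.C (β i)) ∧
    Monotone α ∧ Monotone β ∧
    ∀ i : Fin d, α i.castSucc ≤ β i ∧ β i ≤ α i.succ

/-- The form `g` interlaces the form `f` with respect to `e`: `deg g = deg f - 1`, and `g(te + a)`
interlaces `f(te + a)` for every real `a`. -/
def Interlaces {σ : Type*} (g f : MvPolynomial σ ℝ) (e : σ → ℝ) : Prop :=
  (∃ d : ℕ, f.IsHomogeneous (d + 1) ∧ g.IsHomogeneous d) ∧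
    ∀ a : σ → ℝ, UnivInterlaces (restrictToLine g e a) (restrictToLine f e a)

/-! ### Plane projective curves and their points -/

/-- The complex projective plane. -/
abbrev Plane : Type := Projectivization ℂ (Fin 3 → ℂ)

/-- The form with real coefficients `f`, viewed over the complex numbers. -/
abbrev complexify (f : MvPolynomial (Fin 3) ℝ) : MvPolynomial (Fin 3) ℂ :=
  map (algebraMap ℝ ℂ) f

/-- The set of complex points of the projective plane curve defined by the form `f`. -/
def complexCurve (f : MvPolynomial (Fin 3) ℂ) : Set Plane :=
  {P | eval P.rep f = 0}

/-- Singular points of the curve defined by `f`: the points of the curve at which all first partial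
derivatives of `f` vanish. -/
def singularPoints (f : MvPolynomial (Fin 3) ℂ) : Set Plane :=
  {P | P ∈ complexCurve f ∧ ∀ i, eval P.rep (pderiv i f) = 0}

/-- A point of the complex projective plane is real if it has real homogeneous coordinates. -/
def IsRealPoint (P : Plane) : Prop :=
  ∃ (v : Fin 3 → ℝ) (h : (fun i => (v i : ℂ)) ≠ 0), P = Projectivization.mk ℂ (fun i => (v i : ℂ)) h

/-- Complex conjugation of points `[x : y : z] ↦ [x̄ : ȳ : z̄]`. -/
def conjPoint : Plane → Plane :=
  Projectivization.map ((starLinearEquiv ℂ (A := Fin 3 → ℂ)).toLinearMap)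
    (starLinearEquiv ℂ (A := Fin 3 → ℂ)).injective

/-! ### Intersection multiplicity -/

/-- The maximal ideal of polynomials vanishing at `p ∈ ℂ³`. -/
def pointIdeal (p : Fin 3 → ℂ) : Ideal (MvPolynomial (Fin 3) ℂ) :=
  RingHom.ker (eval p)

instance (p : Fin 3 → ℂ) : (pointIdeal p).IsPrime :=
  RingHom.ker_isPrime (eval p)

/-- The local ring of `ℂ³` at `p`. -/
abbrev LocalRingAt (p : Fin 3 → ℂ) : Type := Localization.AtPrime (pointIdeal p)

/-- The equation `ℓ - ℓ(p)`, where `ℓ = p̄₀x₀ + p̄₁x₁ + p̄₂x₂`. When `p ≠ 0`, `ℓ(p) = |p|² ≠ 0`, so that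
this plane of `ℂ³` is an affine chart of the projective plane around `[p]`
(the complement of the line `ℓ = 0`), in which `p` represents `[p]`. -/
def chartEquation (p : Fin 3 → ℂ) : MvPolynomial (Fin 3) ℂ :=
  ∑ i, C (star (p i)) * (X i - C (p i))

/-- The ideal generated by `f`, `g` and the equation of the affine chart in the local ring of `ℂ³`
at `p`. -/
def intersectionIdeal (f g : MvPolynomial (Fin 3) ℂ) (p : Fin 3 → ℂ) : Ideal (LocalRingAt p) :=
  Ideal.span {algebraMap _ (LocalRingAt p) f, algebraMap _ (LocalRingAt p) g,
    algebraMap _ (LocalRingAt p) (chartEquation p)}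

/-- The intersection multiplicity `I_P(f, g)`: the complex dimension of `𝒪_P / (f, g)`, where `𝒪_P`
is the local ring at `P` of an affine chart of the projective plane, in which `f` and `g` are
dehomogenized. It is infinite if `f` and `g` share a factor that vanishes at `P`. -/
def intersectionMultiplicity (f g : MvPolynomial (Fin 3) ℂ) (P : Plane) : ℕ∞ :=
  Cardinal.toENat (Module.rank ℂ (LocalRingAt P.rep ⧸ intersectionIdeal f g P.rep))

/-! ### Divisors and real contact -/

/-- The group `Div(f)` of divisors on the curve defined by `f`: finite formal integral combinations
of its complex points. -/
def divisorsOn (f : MvPolynomial (Fin 3) ℂ) : Submodule ℤ (Plane →₀ ℤ) :=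
  Finsupp.supported ℤ ℤ (complexCurve f)

/-- The conjugate divisor `∑ nᵢ P̄ᵢ` of `∑ nᵢ Pᵢ`. -/
def conjDivisor (D : Plane →₀ ℤ) : Plane →₀ ℤ :=
  D.mapDomain conjPoint

/-- `E` is the intersection divisor `f.g = ∑ I_P(f, g) P`, summed over the common zeros `P` of `f` and
`g`; in particular all these multiplicities are finite. -/
def IsIntersectionDivisor (f g : MvPolynomial (Fin 3) ℂ) (E : Plane →₀ ℤ) : Prop :=
  (∀ P ∈ complexCurve f ∩ complexCurve g,
      ∃ n : ℕ, intersectionMultiplicity f g P = n ∧ E P = n) ∧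
    ∀ P ∉ complexCurve f ∩ complexCurve g, E P = 0

/-- The curve defined by `g` is a curve of real contact of the curve defined by `f`: there is a
divisor `D` on the latter with `f.g = D + D̄`. -/
def IsCurveOfRealContact (f g : MvPolynomial (Fin 3) ℝ) : Prop :=
  ∃ D ∈ divisorsOn (complexify f),
    IsIntersectionDivisor (complexify f) (complexify g) (D + conjDivisor D)

end

end RealContact

/-! Let `D_e f` be the derivative of `f` in direction `e`. At a real zero `a` of `f`, interlacing of
the roots of `f(te + a)` and `g(te + a)` forces `D_e f(a) · g(a)` to be zero or to have the sign of
`f(e) g(e)` (`Interlaces.sign`). At a smooth real point `D_e f` does not vanish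
(`Interlaces.directionalDeriv_eq_zero`): otherwise, on moving the line off the point to a suitable
side, Laguerre's inequality would keep all roots away from `0`, although their product tends to `0`.
So near such a point `g` does not change sign along the real curve.

At a smooth real point the maximal ideal of the local ring of the curve is generated by an affine
linear form `π`, which takes both signs on the real curve near the point. If the intersection
multiplicity is a finite number `n`, then `g` is a unit times `π ^ n` on the curve, and constancy of
sign makes `n` even (`even_of_sign`). Common factors play no role here, which gives the second
claim.

For the first claim, elimination turns coprimality over `ℝ` into fixed polynomial equations for the
ratios of coordinates, so the common zeros and their multiplicities are finite
(`finite_commonZeros`, `finite_quotient_intersectionIdeal`). Conjugate points have equal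
multiplicities by a semilinear isomorphism of local rings (`rank_quotient_intersectionIdeal_twist`).
Hence `D` may take half the multiplicity at each real point and all of it at one point of each
conjugate pair (`exists_add_conjDivisor`). -/

namespace RealContact

open MvPolynomial

noncomputable section

/-! ### Restriction of forms to lines in direction `e` -/

section Restriction

variable {σ : Type*}

/-- The derivative of `f` in the constant direction `e`. -/
def directionalDeriv [Fintype σ] (e : σ → ℝ) (f : MvPolynomial σ ℝ) : MvPolynomial σ ℝ :=
  ∑ i, C (e i) * pderiv i f

lemma eval_restrictToLine (f : MvPolynomial σ ℝ) (e a : σ → ℝ) (t : ℝ) :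
    (restrictToLine f e a).eval t = eval (fun i => a i + t * e i) f := by
  unfold restrictToLine
  rw [← Polynomial.coe_evalRingHom, ← AlgHom.coe_toRingHom, ← RingHom.comp_apply]
  congr 1
  ext i
  · simp
  · simp; ring

lemma derivative_restrictToLine [Fintype σ] (f : MvPolynomial σ ℝ) (e a : σ → ℝ) :
    Polynomial.derivative (restrictToLine f e a) =
      restrictToLine (directionalDeriv e f) e a := by
  induction f using MvPolynomial.induction_on with
  | C r => simp [restrictToLine, directionalDeriv]
  | add p q hp hq =>
    simp only [restrictToLine, directionalDeriv, map_add, mul_add, Finset.sum_add_distrib] at *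
    rw [hp, hq]
  | mul_X p i hp =>
    have h1 : directionalDeriv e (p * X i) = directionalDeriv e p * X i + p * C (e i) := by
      classical
      have h2 : ∑ j, C (e j) * (p * pderiv j (X i)) = p * C (e i) := by
        rw [Finset.sum_eq_single i]
        · simp [mul_comm]
        · intro j _ hj
          rw [pderiv_X_of_ne hj.symm]; simp
        · simp
      simp only [directionalDeriv, Derivation.leibniz, smul_eq_mul, mul_add,
        Finset.sum_add_distrib, h2, Finset.sum_mul]
      rw [add_comm]
      congr 1
      exact Finset.sum_congr rfl fun j _ => by ring
    rw [h1]
    simp only [restrictToLine, map_add, map_mul, Polynomial.derivative_mul, aeval_X] at *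
    rw [hp]
    simp

lemma eval_directionalDeriv [Fintype σ] (f : MvPolynomial σ ℝ) (e a : σ → ℝ) :
    eval a (directionalDeriv e f) = ∑ i, e i * eval a (pderiv i f) := by
  simp [directionalDeriv]

lemma natDegree_restrictToLine_le {f : MvPolynomial σ ℝ} {d : ℕ} (hf : f.IsHomogeneous d)
    (e a : σ → ℝ) : (restrictToLine f e a).natDegree ≤ d := by
  unfold restrictToLine
  rw [aeval_def, eval₂_eq]
  refine Polynomial.natDegree_sum_le_of_forall_le _ _ fun m hm => ?_
  refine (Polynomial.natDegree_C_mul_le _ _).trans ((Polynomial.natDegree_prod_le _ _).trans ?_)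
  rw [hf.degree_eq_sum_deg_support hm]
  refine Finset.sum_le_sum fun i _ => ?_
  refine Polynomial.natDegree_pow_le.trans ?_
  have : (Polynomial.X * Polynomial.C (e i) + Polynomial.C (a i)).natDegree ≤ 1 := by
    compute_degree
  nlinarith

lemma natDegree_prod_le_and_coeff_prod {ι R : Type*} [CommSemiring R] (s : Finset ι)
    (n : ι → ℕ) (p : ι → Polynomial R) (h : ∀ i ∈ s, (p i).natDegree ≤ n i) :
    (∏ i ∈ s, p i).natDegree ≤ ∑ i ∈ s, n i ∧
      (∏ i ∈ s, p i).coeff (∑ i ∈ s, n i) = ∏ i ∈ s, (p i).coeff (n i) := by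
  classical
  induction s using Finset.induction_on with
  | empty => simp
  | insert i s hi ih =>
    obtain ⟨h1, h2⟩ := ih fun j hj => h j (Finset.mem_insert_of_mem hj)
    have h3 := h i (Finset.mem_insert_self i s)
    rw [Finset.prod_insert hi, Finset.sum_insert hi, Finset.prod_insert hi, ← h2]
    exact ⟨Polynomial.natDegree_mul_le_of_le h3 h1,
      Polynomial.coeff_mul_add_eq_of_natDegree_le h3 h1⟩

/-- Only the terms `X * C (e i)` reach the top degree. Since the result is independent of `a`, `f(e)
≠ 0` fixes degree and leading coefficient on all parallel lines at once. -/
lemma coeff_restrictToLine {f : MvPolynomial σ ℝ} {d : ℕ} (hf : f.IsHomogeneous d)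
    (e a : σ → ℝ) : (restrictToLine f e a).coeff d = eval e f := by
  unfold restrictToLine
  rw [aeval_def, eval₂_eq, Polynomial.finsetSum_coeff, eval_eq]
  refine Finset.sum_congr rfl fun m hm => ?_
  rw [Polynomial.algebraMap_eq, Polynomial.coeff_C_mul, hf.degree_eq_sum_deg_support hm]
  have h1 : ∀ i, (Polynomial.X * Polynomial.C (e i) + Polynomial.C (a i)).natDegree ≤ 1 :=
    fun i => by compute_degree
  rw [(natDegree_prod_le_and_coeff_prod m.support m _ fun i _ => ?_).2]
  · congr 1
    refine Finset.prod_congr rfl fun i _ => ?_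
    have := Polynomial.coeff_pow_of_natDegree_le (m := m i) (h1 i)
    rw [mul_one] at this
    rw [this]
    simp
  · simpa using Polynomial.natDegree_pow_le_of_le (m i) (h1 i)

end Restriction

/-! ### Real-rooted univariate polynomials -/

section RealRooted

/-- Laguerre's inequality, with a lower bound in terms of any given zero. -/
lemma laguerre_multiset (c : ℝ) (s : Multiset ℝ) (x : ℝ) :
    let p := Polynomial.C c * (s.map fun a => (Polynomial.X - Polynomial.C a)).prod
    0 ≤ p.derivative.eval x ^ 2 - p.eval x * p.derivative.derivative.eval x ∧
    ∀ a ∈ s, p.eval x ^ 2 ≤ (x - a) ^ 2 *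
      (p.derivative.eval x ^ 2 - p.eval x * p.derivative.derivative.eval x) := by
  induction s using Multiset.induction_on with
  | empty => simp
  | cons b s ih =>
    intro p
    set q := Polynomial.C c * (s.map fun a => (Polynomial.X - Polynomial.C a)).prod with hq
    have hp : p = (Polynomial.X - Polynomial.C b) * q := by
      simp only [p, hq, Multiset.map_cons, Multiset.prod_cons]; ring
    obtain ⟨h0, h1⟩ := ih
    -- Adding the factor `X - b` changes the Laguerre expression `L` by `L_p = q² + (x - b)² L_q`,
    -- which drives both halves of the induction.
    have hL : p.derivative.eval x ^ 2 - p.eval x * p.derivative.derivative.eval x =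
        q.eval x ^ 2 + (x - b) ^ 2 *
          (q.derivative.eval x ^ 2 - q.eval x * q.derivative.derivative.eval x) := by
      rw [hp]
      simp [Polynomial.derivative_mul]
      ring
    have hpe : p.eval x = (x - b) * q.eval x := by rw [hp]; simp
    rw [hL, hpe]
    refine ⟨by positivity, fun a ha => ?_⟩
    rcases Multiset.mem_cons.1 ha with rfl | ha
    · have : 0 ≤ (x - a) ^ 2 * ((x - a) ^ 2 *
        (q.derivative.eval x ^ 2 - q.eval x * q.derivative.derivative.eval x)) := by positivity
      nlinarith
    · have := mul_le_mul_of_nonneg_left (h1 a ha) (sq_nonneg (x - b))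
      have h2 : 0 ≤ (x - a) ^ 2 * q.eval x ^ 2 := by positivity
      nlinarith

lemma laguerre_prod {n : ℕ} (c : ℝ) (α : Fin n → ℝ) (x : ℝ) (i : Fin n) :
    let p := Polynomial.C c * ∏ i, (Polynomial.X - Polynomial.C (α i))
    p.eval x ^ 2 ≤ (x - α i) ^ 2 *
      (p.derivative.eval x ^ 2 - p.eval x * p.derivative.derivative.eval x) := by
  have := (laguerre_multiset c (Finset.univ.val.map α) x).2 (α i)
    (Multiset.mem_map_of_mem _ (Finset.mem_univ i))
  simpa only [Multiset.map_map, Function.comp_def, ← Finset.prod_eq_multiset_prod] using this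

/-- At a zero of `p`, the derivative of `p` and an interlacer of `p` have constant relative sign. -/
lemma interlacing_sign {d : ℕ} (α : Fin (d + 1) → ℝ) (β : Fin d → ℝ) (b c : ℝ)
    (hα : Monotone α) (h : ∀ i : Fin d, α i.castSucc ≤ β i ∧ β i ≤ α i.succ) {x : ℝ}
    (hx : (Polynomial.C c * ∏ i, (Polynomial.X - Polynomial.C (α i))).eval x = 0) :
    0 ≤ (c * b) *
      ((Polynomial.C c * ∏ i, (Polynomial.X - Polynomial.C (α i))).derivative.eval x *
        (Polynomial.C b * ∏ i, (Polynomial.X - Polynomial.C (β i))).eval x) := by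
  by_cases hc : c = 0
  · simp [hc]
  have hx' : ∏ i, (x - α i) = 0 := by
    simpa [Polynomial.eval_prod, hc] using hx
  obtain ⟨i, -, hi⟩ := Finset.prod_eq_zero_iff.1 hx'
  have hi : x = α i := by linarith
  rw [Fin.prod_univ_succAbove _ i]
  have h1 : (Polynomial.C c * ((Polynomial.X - Polynomial.C (α i)) *
      ∏ j, (Polynomial.X - Polynomial.C (α (i.succAbove j))))).derivative.eval x =
      c * ∏ j, (x - α (i.succAbove j)) := by
    simp [Polynomial.derivative_mul, Polynomial.eval_prod, hi]
  rw [h1]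
  -- Deleting the root `α i = x` pairs the remaining `d` roots with the `β j`: for `j` below `i`
  -- both members of a pair are at most `x`, otherwise both are at least `x`.
  have h2 : 0 ≤ ∏ j, ((x - α (i.succAbove j)) * (x - β j)) := by
    refine Finset.prod_nonneg fun j _ => ?_
    rcases lt_or_ge j.castSucc i with hj | hj
    · rw [Fin.succAbove_of_castSucc_lt _ _ hj, hi]
      have h3 : α j.succ ≤ α i := hα (by rw [Fin.le_def]; rw [Fin.lt_def] at hj; simpa using hj)
      have := (h j).1; have := (h j).2
      exact mul_nonneg (by linarith) (by linarith)
    · rw [Fin.succAbove_of_le_castSucc _ _ hj, hi]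
      have h3 : α i ≤ α j.castSucc := hα hj
      have := (h j).1; have := (h j).2
      exact mul_nonneg_of_nonpos_of_nonpos (by linarith) (by linarith)
  rw [Finset.prod_mul_distrib] at h2
  simp only [Polynomial.eval_mul, Polynomial.eval_C, Polynomial.eval_prod, Polynomial.eval_sub,
    Polynomial.eval_X]
  nlinarith [mul_nonneg (sq_nonneg (c * b)) h2]

end RealRooted

/-! ### Interlacers on the real zero set of a form -/

section Forms

variable {σ : Type*}

/-- The data of an interlacing, with the leading coefficients identified. -/
lemma Interlaces.exists_roots {f g : MvPolynomial σ ℝ} {e : σ → ℝ} (hfe : eval e f ≠ 0)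
    (hg : Interlaces g f e) :
    ∃ d : ℕ, f.IsHomogeneous (d + 1) ∧ g.IsHomogeneous d ∧ eval e g ≠ 0 ∧
      ∀ a : σ → ℝ, ∃ (α : Fin (d + 1) → ℝ) (β : Fin d → ℝ), Monotone α ∧
        (∀ i : Fin d, α i.castSucc ≤ β i ∧ β i ≤ α i.succ) ∧
        restrictToLine f e a =
          Polynomial.C (eval e f) * ∏ i, (Polynomial.X - Polynomial.C (α i)) ∧
        restrictToLine g e a =
          Polynomial.C (eval e g) * ∏ i, (Polynomial.X - Polynomial.C (β i)) := by
  obtain ⟨⟨d, hfd, hgd⟩, h⟩ := hg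
  have key : ∀ a : σ → ℝ, eval e g ≠ 0 ∧ ∃ (α : Fin (d + 1) → ℝ) (β : Fin d → ℝ), Monotone α ∧
        (∀ i : Fin d, α i.castSucc ≤ β i ∧ β i ≤ α i.succ) ∧
        restrictToLine f e a =
          Polynomial.C (eval e f) * ∏ i, (Polynomial.X - Polynomial.C (α i)) ∧
        restrictToLine g e a =
          Polynomial.C (eval e g) * ∏ i, (Polynomial.X - Polynomial.C (β i)) := by
    intro a
    obtain ⟨d', α, β, b, c, hb, hc, hp, hq, hα, -, hαβ⟩ := h a
    have hmon : ∀ {n : ℕ} (γ : Fin n → ℝ),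
        (∏ i, (Polynomial.X - Polynomial.C (γ i))).Monic ∧
        (∏ i, (Polynomial.X - Polynomial.C (γ i))).natDegree = n := fun γ =>
      ⟨Polynomial.monic_prod_of_monic _ _ fun i _ => Polynomial.monic_X_sub_C _, by simp⟩
    have h1 : (restrictToLine f e a).natDegree = d' + 1 := by
      rw [hp, Polynomial.natDegree_C_mul hc, (hmon α).2]
    have h2 : (restrictToLine f e a).natDegree = d + 1 := by
      refine le_antisymm (natDegree_restrictToLine_le hfd e a) ?_
      refine Polynomial.le_natDegree_of_ne_zero ?_
      rwa [coeff_restrictToLine hfd]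
    obtain rfl : d' = d := by omega
    have hc' : c = eval e f := by
      rw [← coeff_restrictToLine hfd e a, hp, Polynomial.coeff_C_mul]
      have h3 := (hmon α).1.coeff_natDegree
      rw [(hmon α).2] at h3
      rw [h3, mul_one]
    have hb' : b = eval e g := by
      rw [← coeff_restrictToLine hgd e a, hq, Polynomial.coeff_C_mul]
      have h3 := (hmon β).1.coeff_natDegree
      rw [(hmon β).2] at h3
      rw [h3, mul_one]
    subst hc' hb'
    exact ⟨hb, α, β, hα, hαβ, hp, hq⟩
  exact ⟨d, hfd, hgd, (key 0).1, fun a => (key a).2⟩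

variable [Fintype σ]

/-- On the real zero set of `f`, an interlacer has the sign of the derivative in direction `e`, up to
a constant. -/
lemma Interlaces.sign {f g : MvPolynomial σ ℝ} {e : σ → ℝ} (hfe : eval e f ≠ 0)
    (hg : Interlaces g f e) {a : σ → ℝ} (ha : eval a f = 0) :
    0 ≤ (eval e f * eval e g) * (eval a (directionalDeriv e f) * eval a g) := by
  obtain ⟨d, -, -, -, h⟩ := hg.exists_roots hfe
  obtain ⟨α, β, hα, hαβ, hp, hq⟩ := h a
  have h0 : ∀ F : MvPolynomial σ ℝ, (restrictToLine F e a).eval 0 = eval a F := fun F => by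
    simp [eval_restrictToLine]
  have h1 := interlacing_sign α β (eval e g) (eval e f) hα hαβ (x := 0) (by rw [← hp, h0, ha])
  rwa [← hp, ← hq, derivative_restrictToLine, h0, h0] at h1

/-- The restriction of a polynomial to a line, expanded to first order. -/
lemma exists_eval_line_eq (F : MvPolynomial σ ℝ) (p v : σ → ℝ) :
    ∃ G : Polynomial ℝ, G.eval 0 = eval p (directionalDeriv v F) ∧
      ∀ s : ℝ, eval (fun i => p i + s * v i) F = eval p F + s * G.eval s := by
  refine ⟨(restrictToLine F v p).divX, ?_, fun s => ?_⟩
  · have := congrArg (fun q => Polynomial.eval 0 q) (derivative_restrictToLine F v p)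
    rw [← (restrictToLine F v p).divX_mul_X_add] at this
    simpa [Polynomial.derivative_mul, eval_restrictToLine] using this
  · rw [← eval_restrictToLine]
    conv_lhs => rw [← (restrictToLine F v p).divX_mul_X_add]
    have : (restrictToLine F v p).coeff 0 = eval p F := by
      rw [Polynomial.coeff_zero_eq_eval_zero, eval_restrictToLine]; simp
    simp [this]; ring

lemma directionalDeriv_neg (v : σ → ℝ) (F : MvPolynomial σ ℝ) :
    directionalDeriv (-v) F = -directionalDeriv v F := by
  simp [directionalDeriv]

/-- There is no family of real-rooted polynomials of fixed degree and leading coefficient `c`, with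
constant terms `s G0(s)` and next coefficients `s G1(s)`, `(B + s G2(s)) / 2`, when `G0(0) ≠ 0`: by
Laguerre's inequality the zeros would stay away from `0`, while their product tends to `0`. -/
lemma not_real_rooted_family {d : ℕ} {c A B : ℝ} (hc : c ≠ 0) (hA : A ≠ 0) (hAB : 0 ≤ A * B)
    (G0 G1 G2 : Polynomial ℝ) (hG0 : G0.eval 0 = A)
    (h : ∀ s : ℝ, ∃ α : Fin (d + 1) → ℝ, (s * G0.eval s) ^ 2 = c ^ 2 * ∏ i, α i ^ 2 ∧
      ∀ i, (s * G0.eval s) ^ 2 ≤ α i ^ 2 *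
        ((s * G1.eval s) ^ 2 - s * G0.eval s * (B + s * G2.eval s))) : False := by
  have hG0X : ∀ s, G0.eval s = G0.divX.eval s * s + A := fun s => by
    conv_lhs => rw [← G0.divX_mul_X_add]
    rw [Polynomial.coeff_zero_eq_eval_zero, hG0]
    simp
  set H := G0.divX
  -- With `G0 = A + s H`, the Laguerre expression equals `s² Q(s) - s A B`. For `s > 0` the last
  -- term only helps, because `A * B ≥ 0`.
  set Q : ℝ → ℝ := fun s => G1.eval s ^ 2 - H.eval s * B - G0.eval s * G2.eval s with hQ
  set K := |Q 0| + 1 with hK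
  have hKpos : 0 < K := by positivity
  have hlim : ∀ F : ℝ → ℝ, Continuous F →
      Filter.Tendsto F (nhdsWithin 0 (Set.Ioi 0)) (nhds (F 0)) := fun F hF =>
    (hF.tendsto 0).mono_left nhdsWithin_le_nhds
  have hcQ := hlim Q (by fun_prop)
  have hcG := hlim (fun s => G0.eval s ^ 2) (by fun_prop)
  have hcF := hlim (fun s => (s * G0.eval s) ^ 2) (by fun_prop)
  simp only [hG0, zero_mul, ne_eq, OfNat.ofNat_ne_zero, not_false_eq_true, zero_pow] at hcG hcF
  have hA2 : 0 < A ^ 2 := sq_pos_iff.2 hA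
  -- For small `s > 0`, `G0(s)² > A² / 2` and `Q(s) < K`, so Laguerre bounds every squared root
  -- below by `δ`.
  set δ := A ^ 2 / 2 / K with hδ
  have hδpos : 0 < δ := div_pos (half_pos hA2) hKpos
  have hbound : 0 < c ^ 2 * δ ^ (d + 1) := mul_pos (sq_pos_iff.2 hc) (pow_pos hδpos _)
  obtain ⟨s, hsQ, hsG, hsF, hs⟩ := ((hcQ.eventually_lt_const (u := K)
    (by rw [hK]; linarith [le_abs_self (Q 0)])).and
    ((hcG.eventually_const_lt (half_lt_self hA2)).and
    ((hcF.eventually_lt_const hbound).and self_mem_nhdsWithin))).exists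
  replace hs : 0 < s := hs
  obtain ⟨α, hprod, hL⟩ := h s
  have h5 : (s * G1.eval s) ^ 2 - s * G0.eval s * (B + s * G2.eval s) ≤ s ^ 2 * K := by
    have h6 : (s * G1.eval s) ^ 2 - s * G0.eval s * (B + s * G2.eval s) =
        s ^ 2 * Q s - s * (A * B) := by
      simp only [hQ]
      rw [hG0X]; ring
    rw [h6]
    have := mul_nonneg hs.le hAB
    have h7 : s ^ 2 * Q s ≤ s ^ 2 * K := mul_le_mul_of_nonneg_left hsQ.le (sq_nonneg s)
    linarith
  have hroot : ∀ i, δ ≤ α i ^ 2 := by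
    intro i
    have h8 : s ^ 2 * G0.eval s ^ 2 ≤ s ^ 2 * (α i ^ 2 * K) := calc
      _ = (s * G0.eval s) ^ 2 := by ring
      _ ≤ _ := hL i
      _ ≤ α i ^ 2 * (s ^ 2 * K) := mul_le_mul_of_nonneg_left h5 (sq_nonneg _)
      _ = _ := by ring
    have h9 := le_of_mul_le_mul_left h8 (pow_pos hs 2)
    rw [hδ, div_le_iff₀ hKpos]
    linarith
  have hge : δ ^ (d + 1) ≤ ∏ i, α i ^ 2 := by
    have := Finset.prod_le_prod (s := (Finset.univ : Finset (Fin (d + 1))))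
      (f := fun _ => δ) (g := fun i => α i ^ 2) (fun _ _ => hδpos.le) (fun i _ => hroot i)
    simpa using this
  have := mul_le_mul_of_nonneg_left hge (sq_nonneg c)
  linarith

/-- A real zero of a hyperbolic form that is critical in the direction `e` is singular. -/
lemma Interlaces.directionalDeriv_eq_zero {f g : MvPolynomial σ ℝ} {e : σ → ℝ}
    (hfe : eval e f ≠ 0) (hg : Interlaces g f e) {p : σ → ℝ} (hp : eval p f = 0)
    (hpe : eval p (directionalDeriv e f) = 0) (v : σ → ℝ) :
    eval p (directionalDeriv v f) = 0 := by
  by_contra hne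
  obtain ⟨d, -, -, -, h⟩ := hg.exists_roots hfe
  -- Replacing `v` by `-v` flips the sign of `D_v f` and leaves `D_e D_e f` alone: this is the
  -- choice of the side to which the line moves.
  wlog hAB : 0 ≤ eval p (directionalDeriv v f) *
      eval p (directionalDeriv e (directionalDeriv e f)) generalizing v with H
  · refine H (-v) ?_ ?_
    · simpa [directionalDeriv_neg] using hne
    · rw [directionalDeriv_neg, map_neg]
      linarith
  obtain ⟨G0, hG0, h0⟩ := exists_eval_line_eq f p v
  obtain ⟨G1, -, h1⟩ := exists_eval_line_eq (directionalDeriv e f) p v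
  obtain ⟨G2, -, h2⟩ := exists_eval_line_eq (directionalDeriv e (directionalDeriv e f)) p v
  simp only [hp, hpe, zero_add] at h0 h1
  -- The family is `t ↦ f(te + p + sv)`. Its value and first two derivatives at `t = 0` are those of
  -- `f` in direction `e` at `p + sv`.
  refine not_real_rooted_family (d := d) hfe hne hAB G0 G1 G2 hG0 fun s => ?_
  obtain ⟨α, -, -, -, hα, -⟩ := h (fun i => p i + s * v i)
  have he0 : ∀ F : MvPolynomial σ ℝ, (restrictToLine F e (fun i => p i + s * v i)).eval 0 =
      eval (fun i => p i + s * v i) F := fun F => by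
    simp [eval_restrictToLine]
  refine ⟨α, ?_, fun i => ?_⟩
  · rw [← h0, ← he0, hα]
    simp only [Polynomial.eval_mul, Polynomial.eval_C, Polynomial.eval_prod, Polynomial.eval_sub,
      Polynomial.eval_X, mul_pow, ← Finset.prod_pow]
    simp
  · have hL := laguerre_prod (eval e f) α 0 i
    simp only [← hα, derivative_restrictToLine, he0] at hL
    rw [h0, h1, h2] at hL
    simpa using hL

end Forms

/-! ### Elimination for relatively prime forms -/

section Elimination

/-- Relatively prime polynomials over a factorial ring generate an ideal containing a nonzero constant. -/
lemma exists_C_mem_span_of_isRelPrime {R : Type*} [CommRing R] [IsDomain R]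
    [UniqueFactorizationMonoid R] {f g : Polynomial R} (h : IsRelPrime f g) (hf : f ≠ 0) :
    ∃ r : R, r ≠ 0 ∧ Polynomial.C r ∈ Ideal.span {f, g} := by
  let _ : StrongNormalizationMonoid R := UniqueFactorizationMonoid.strongNormalizationMonoid
  let _ : NormalizedGCDMonoid R := UniqueFactorizationMonoid.toNormalizedGCDMonoid R
  let K := FractionRing R
  have hinj : Function.Injective (algebraMap R K) := IsFractionRing.injective R K
  -- Gauss's lemma: a common divisor over the fraction field is associated there to a primitive
  -- polynomial over `R`, which then divides `f` and `g` over `R`.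
  have hco : IsCoprime (f.map (algebraMap R K)) (g.map (algebraMap R K)) := by
    rw [← isRelPrime_iff_isCoprime]
    intro d hdf hdg
    have hd0 : d ≠ 0 := by
      rintro rfl
      exact hf ((Polynomial.map_eq_zero_iff hinj).1 (zero_dvd_iff.1 hdf))
    obtain ⟨b, hb, hbd⟩ := IsLocalization.integerNormalization_spec (nonZeroDivisors R) d
    set D := IsLocalization.integerNormalization (nonZeroDivisors R) d
    have hb0 : algebraMap R K b ≠ 0 := by
      rw [Ne, map_eq_zero_iff _ hinj]; exact nonZeroDivisors.ne_zero hb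
    have hDd : Associated (D.map (algebraMap R K)) d := by
      rw [hbd, Algebra.smul_def, Polynomial.algebraMap_apply]
      exact associated_unit_mul_left _ _ (Polynomial.isUnit_C.2 (IsUnit.mk0 _ hb0))
    have hD0 : D ≠ 0 := by
      intro h0
      rw [h0, Polynomial.map_zero] at hDd
      exact hd0 (hDd.symm.eq_zero_iff.2 rfl)
    have hPd : Associated (D.primPart.map (algebraMap R K)) d := by
      refine Associated.trans ?_ hDd
      conv_rhs => rw [D.eq_C_content_mul_primPart, Polynomial.map_mul, Polynomial.map_C]
      refine (associated_unit_mul_left _ _ (Polynomial.isUnit_C.2 (IsUnit.mk0 _ ?_))).symm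
      rw [Ne, map_eq_zero_iff _ hinj]
      exact fun h => hD0 (Polynomial.content_eq_zero_iff.1 h)
    have hu := h
      (D.isPrimitive_primPart.dvd_of_fraction_map_dvd_fraction_map (K := K)
        (hPd.dvd_iff_dvd_left.2 hdf))
      (D.isPrimitive_primPart.dvd_of_fraction_map_dvd_fraction_map (K := K)
        (hPd.dvd_iff_dvd_left.2 hdg))
    exact hPd.isUnit (hu.map (Polynomial.mapRingHom (algebraMap R K)))
  obtain ⟨u, v, huv⟩ := hco
  obtain ⟨b, hb, hbu⟩ := IsLocalization.integerNormalization_spec (nonZeroDivisors R) u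
  obtain ⟨c, hc, hcv⟩ := IsLocalization.integerNormalization_spec (nonZeroDivisors R) v
  set U := IsLocalization.integerNormalization (nonZeroDivisors R) u
  set V := IsLocalization.integerNormalization (nonZeroDivisors R) v
  refine ⟨b * c, mul_ne_zero (nonZeroDivisors.ne_zero hb) (nonZeroDivisors.ne_zero hc),
    Ideal.mem_span_pair.2 ⟨Polynomial.C c * U, Polynomial.C b * V, ?_⟩⟩
  apply Polynomial.map_injective _ hinj
  simp only [Polynomial.map_add, Polynomial.map_mul, Polynomial.map_C, hbu, hcv, map_mul]
  rw [Algebra.smul_def, Algebra.smul_def, Polynomial.algebraMap_apply, Polynomial.algebraMap_apply]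
  linear_combination Polynomial.C (algebraMap R K b) * Polynomial.C (algebraMap R K c) * huv

/-- Elimination of the variable indexed by `none`. -/
lemma exists_rename_mem_span {σ k : Type*} [Field k] {f g : MvPolynomial (Option σ) k}
    (h : IsRelPrime f g) (hf : f ≠ 0) :
    ∃ r : MvPolynomial σ k, r ≠ 0 ∧ rename some r ∈ Ideal.span {f, g} := by
  let E := optionEquivLeft k σ
  have hE : IsRelPrime (E f) (E g) := by
    intro d hdf hdg
    have := h (d := E.symm d) (by simpa using map_dvd E.symm hdf) (by simpa using map_dvd E.symm hdg)
    simpa using this.map E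
  obtain ⟨r, hr, hmem⟩ := exists_C_mem_span_of_isRelPrime hE (by simpa using hf)
  refine ⟨r, hr, ?_⟩
  obtain ⟨u, v, huv⟩ := Ideal.mem_span_pair.1 hmem
  refine Ideal.mem_span_pair.2 ⟨E.symm u, E.symm v, E.injective ?_⟩
  rw [map_add, map_mul, map_mul, E.apply_symm_apply, E.apply_symm_apply, huv]
  have : (E.toAlgHom.comp (rename some)).toRingHom = Polynomial.C := by
    refine ringHom_ext (fun c => ?_) fun i => ?_ <;> simp [E]
  exact (DFunLike.congr_fun this r).symm

lemma exists_rename_mem_span_fin {k : Type*} [Field k] {f g : MvPolynomial (Fin 3) k}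
    (h : IsRelPrime f g) (hf : f ≠ 0) (l : Fin 3) :
    ∃ r : MvPolynomial {i // i ≠ l} k, r ≠ 0 ∧ rename Subtype.val r ∈ Ideal.span {f, g} := by
  classical
  let ε : Fin 3 ≃ Option {i // i ≠ l} := (Equiv.optionSubtypeNe l).symm
  let E := renameEquiv k ε
  have hE : IsRelPrime (E f) (E g) := by
    intro d hdf hdg
    have := h (d := E.symm d) (by simpa using map_dvd E.symm hdf) (by simpa using map_dvd E.symm hdg)
    simpa using this.map E
  obtain ⟨r, hr, hmem⟩ := exists_rename_mem_span hE (by simpa using hf)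
  refine ⟨r, hr, ?_⟩
  obtain ⟨u, v, huv⟩ := Ideal.mem_span_pair.1 hmem
  refine Ideal.mem_span_pair.2 ⟨E.symm u, E.symm v, E.injective ?_⟩
  rw [map_add, map_mul, map_mul, E.apply_symm_apply, E.apply_symm_apply, huv]
  simp only [E, renameEquiv_apply, rename_rename]
  congr 2
  funext i
  simp [ε, i.2]

/-- For relatively prime forms, the ratio of two coordinates at a common zero (with values in any
algebra) satisfies a fixed nontrivial algebraic equation. -/
lemma exists_polynomial_ratio {k : Type*} [Field k] {f g : MvPolynomial (Fin 3) k} {m n : ℕ}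
    (hfm : f.IsHomogeneous m) (hgn : g.IsHomogeneous n) (h : IsRelPrime f g) (hf : f ≠ 0)
    (i j : Fin 3) :
    ∃ q : Polynomial k, q ≠ 0 ∧ ∀ (B : Type) [CommRing B] [Algebra k B] (b : Fin 3 → B) (y : B),
      aeval b f = 0 → aeval b g = 0 → b i = b j * y → IsUnit (b j) → Polynomial.aeval y q = 0 := by
  rcases eq_or_ne i j with rfl | hij
  · refine ⟨Polynomial.X - 1, Polynomial.X_sub_C_ne_zero 1, fun B _ _ b y _ _ hy hu => ?_⟩
    have : b i * 1 = b i * y := by rw [mul_one]; exact hy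
    have := hu.mul_left_cancel this
    simp [← this]
  obtain ⟨l, hli, hlj⟩ : ∃ l : Fin 3, l ≠ i ∧ l ≠ j := by
    revert i j; decide
  have hl : ∀ x : Fin 3, x ≠ l → x = i ∨ x = j := by
    clear * - hli hlj hij
    revert i j l; decide
  obtain ⟨r, hr, hmem⟩ := exists_rename_mem_span_fin h hf l
  set H := rename Subtype.val r with hH
  have hH0 : H ≠ 0 := by
    rw [hH, Ne, map_eq_zero_iff _ (rename_injective _ Subtype.val_injective)]; exact hr
  -- The ideal is homogeneous, so a nonzero homogeneous component of the eliminant still lies in it.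
  -- It is a binary form in `X i` and `X j`.
  obtain ⟨N, hN⟩ : ∃ N, homogeneousComponent N H ≠ 0 := by
    by_contra! hcon
    exact hH0 (by rw [← sum_homogeneousComponent H]; exact Finset.sum_eq_zero fun N _ => hcon N)
  set F := homogeneousComponent N H with hF
  have hFmem : F ∈ Ideal.span {f, g} := by
    let _ := gradedAlgebra (σ := Fin 3) (R := k)
    have hI := Ideal.homogeneous_span (homogeneousSubmodule (Fin 3) k) {f, g} (by
      rintro x (rfl | rfl)
      · exact ⟨m, hfm⟩
      · exact ⟨n, hgn⟩)
    exact (mem_iff_homogeneousComponent_mem hI H).1 hmem N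
  have hFhom : F.IsHomogeneous N := homogeneousComponent_isHomogeneous N H
  have hsupp : ∀ a ∈ F.support, a l = 0 := by
    intro a ha
    have h1 : coeff a H ≠ 0 := by
      intro h0
      rw [mem_support_iff, hF, coeff_homogeneousComponent] at ha
      simp [h0] at ha
    obtain ⟨b, rfl, -⟩ := coeff_rename_ne_zero _ _ _ h1
    exact Finsupp.mapDomain_of_notMem_range _ _ (by simp)
  have hdeg : ∀ a ∈ F.support, a i + a j = N := by
    intro a ha
    have h1 := hFhom (mem_support_iff.1 ha)
    rw [Finsupp.weight_apply, Finsupp.sum_fintype _ _ (by simp),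
      ← Finset.sum_subset (Finset.subset_univ {i, j}), Finset.sum_pair hij] at h1
    · simpa using h1
    · intro x _ hx
      have : x = l := by
        by_contra hxl
        exact hx (by simpa using hl x hxl)
      rw [this, hsupp a ha]; simp
  -- This is `F` dehomogenized at `X j = 1`. Monomials do not collide, since `a j = N - a i`; and
  -- `F(b) = b j ^ N * q(y)` with `b j` a unit.
  refine ⟨∑ a ∈ F.support, Polynomial.monomial (a i) (coeff a F), ?_, ?_⟩
  · obtain ⟨a, ha⟩ := Finset.nonempty_iff_ne_empty.2 (support_eq_empty.not.2 hN)
    intro h0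
    have h1 := congrArg (fun q => q.coeff (a i)) h0
    simp only [Polynomial.finsetSum_coeff, Polynomial.coeff_monomial, Polynomial.coeff_zero] at h1
    rw [Finset.sum_eq_single a] at h1
    · simp at h1; exact (mem_support_iff.1 ha) h1
    · intro b hb hba
      rw [if_neg]
      intro hbi
      apply hba
      ext x
      have h2 := hdeg a ha
      have h3 := hdeg b hb
      by_cases hx : x = l
      · rw [hx, hsupp a ha, hsupp b hb]
      · rcases hl x hx with rfl | rfl
        · exact hbi
        · omega
    · exact fun h => absurd ha h
  · intro B _ _ b y hbf hbg hy hu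
    have h1 : aeval b F = 0 := by
      obtain ⟨u, v, huv⟩ := Ideal.mem_span_pair.1 hFmem
      rw [← huv, map_add, map_mul, map_mul, hbf, hbg]; simp
    rw [aeval_def, eval₂_eq'] at h1
    have h2 : b j ^ N * Polynomial.aeval y (∑ a ∈ F.support, Polynomial.monomial (a i) (coeff a F)) = 0 := by
      rw [← h1, map_sum, Finset.mul_sum]
      refine Finset.sum_congr rfl fun a ha => ?_
      have h3 : ∏ x, b x ^ a x = b i ^ a i * b j ^ a j := by
        rw [← Finset.prod_subset (Finset.subset_univ {i, j}), Finset.prod_pair hij]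
        intro x _ hx
        have : x = l := by
          by_contra hxl
          exact hx (by simpa using hl x hxl)
        rw [this, hsupp a ha, pow_zero]
      rw [h3, hy, Polynomial.aeval_monomial, ← hdeg a ha]
      ring
    exact ((hu.pow N).mul_right_eq_zero).1 h2

end Elimination

/-! ### Rescaling and conjugation of local rings -/

section Semilinear

/-- The ring automorphism `F ↦ F^τ(λ⁻¹ x)` of the polynomial ring. -/
def twist (τ : ℂ ≃+* ℂ) (c : ℂ) (hc : c ≠ 0) :
    MvPolynomial (Fin 3) ℂ ≃+* MvPolynomial (Fin 3) ℂ :=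
  RingEquiv.ofRingHom
    (eval₂Hom (C.comp (τ : ℂ →+* ℂ)) fun i => C c⁻¹ * X i)
    (eval₂Hom (C.comp (τ.symm : ℂ →+* ℂ)) fun i => C (τ.symm c) * X i)
    (by
      refine ringHom_ext (fun r => by simp) fun i => ?_
      simp only [RingHom.comp_apply, coe_eval₂Hom, eval₂_X, eval₂_mul, eval₂_C, RingHom.id_apply]
      rw [← mul_assoc, ← C_mul]
      simp [hc])
    (by
      refine ringHom_ext (fun r => by simp) fun i => ?_
      simp only [RingHom.comp_apply, coe_eval₂Hom, eval₂_X, eval₂_mul, eval₂_C, RingHom.id_apply]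
      rw [← mul_assoc, ← C_mul]
      simp [hc])

variable {τ : ℂ ≃+* ℂ} {c : ℂ} (hc : c ≠ 0)

@[simp] lemma twist_C (r : ℂ) : twist τ c hc (C r) = C (τ r) := by simp [twist]

@[simp] lemma twist_X (i : Fin 3) : twist τ c hc (X i) = C c⁻¹ * X i := by simp [twist]

lemma eval_twist (F : MvPolynomial (Fin 3) ℂ) (p : Fin 3 → ℂ) :
    eval (fun i => c * τ (p i)) (twist τ c hc F) = τ (eval p F) := by
  have : (eval fun i => c * τ (p i)).comp (twist τ c hc).toRingHom =
      (τ : ℂ →+* ℂ).comp (eval p) := by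
    refine ringHom_ext (fun r => by simp) fun i => ?_
    simp [hc]
  exact DFunLike.congr_fun this F

lemma twist_of_isHomogeneous {F : MvPolynomial (Fin 3) ℂ} {m : ℕ} (hF : F.IsHomogeneous m)
    (hτ : map (τ : ℂ →+* ℂ) F = F) : twist τ c hc F = C (c⁻¹ ^ m) * F := by
  have h1 : twist τ c hc F = eval₂ C (fun i => C c⁻¹ * X i) F := by
    conv_rhs => rw [← hτ]
    rw [eval₂_map]
    rfl
  rw [h1, eval₂_eq]
  conv_rhs => rw [F.as_sum, Finset.mul_sum]
  refine Finset.sum_congr rfl fun a ha => ?_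
  rw [hF.degree_eq_sum_deg_support ha]
  simp only [mul_pow, Finset.prod_mul_distrib, Finset.prod_pow_eq_pow_sum, C_pow]
  rw [monomial_eq, Finsupp.prod]
  ring

/-- Together with `twist_of_isHomogeneous`, this shows that all three generators of the intersection
ideal are carried to nonzero constant multiples of the corresponding generators at the new point. -/
lemma chartEquation_twist (hstar : ∀ z, τ (star z) = star (τ z)) (p : Fin 3 → ℂ) :
    chartEquation (fun i => c * τ (p i)) = C (star c * c) * twist τ c hc (chartEquation p) := by
  simp only [chartEquation, map_sum, map_mul, map_sub, twist_C, twist_X, Finset.mul_sum, hstar]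
  refine Finset.sum_congr rfl fun i _ => ?_
  have h : (C c : MvPolynomial (Fin 3) ℂ) * C c⁻¹ = 1 := by rw [← C_mul]; simp [hc]
  simp only [star_mul', C_mul]
  linear_combination -(C (star c) * C (star (τ (p i))) * X i) * h

/-- The intersection multiplicity does not depend on the representative, and is invariant under
conjugation. -/
lemma rank_quotient_intersectionIdeal_twist (hstar : ∀ z, τ (star z) = star (τ z))
    {f g : MvPolynomial (Fin 3) ℂ} {m n : ℕ} (hf : f.IsHomogeneous m) (hg : g.IsHomogeneous n)
    (hτf : map (τ : ℂ →+* ℂ) f = f) (hτg : map (τ : ℂ →+* ℂ) g = g) (hc : c ≠ 0)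
    {p q : Fin 3 → ℂ} (hq : ∀ i, q i = c * τ (p i)) :
    Module.rank ℂ (LocalRingAt q ⧸ intersectionIdeal f g q) =
      Module.rank ℂ (LocalRingAt p ⧸ intersectionIdeal f g p) := by
  obtain rfl : q = fun i => c * τ (p i) := funext hq
  have hM : Submonoid.map (twist τ c hc).toMonoidHom (pointIdeal p).primeCompl =
      (pointIdeal fun i => c * τ (p i)).primeCompl := by
    have key : ∀ F, F ∈ (pointIdeal p).primeCompl ↔
        twist τ c hc F ∈ (pointIdeal fun i => c * τ (p i)).primeCompl := by
      intro F
      simp only [Ideal.mem_primeCompl_iff, pointIdeal, RingHom.mem_ker, eval_twist]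
      simp
    ext F
    constructor
    · rintro ⟨G, hG, rfl⟩
      exact (key G).1 hG
    · intro hF
      refine ⟨(twist τ c hc).symm F, (key _).2 (by simpa using hF), by simp⟩
  let Ψ : LocalRingAt p ≃+* LocalRingAt (fun i => c * τ (p i)) :=
    IsLocalization.ringEquivOfRingEquiv _ _ (twist τ c hc) hM
  have hΨ : ∀ F, Ψ (algebraMap _ _ F) = algebraMap _ _ (twist τ c hc F) := fun F =>
    IsLocalization.ringEquivOfRingEquiv_eq hM F
  have hu : ∀ r : ℂ, r ≠ 0 → IsUnit (algebraMap (MvPolynomial (Fin 3) ℂ)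
      (LocalRingAt fun i => c * τ (p i)) (C r)) := fun r hr =>
    ((IsUnit.mk0 r hr).map C).map _
  have hJ : intersectionIdeal f g (fun i => c * τ (p i)) =
      (intersectionIdeal f g p).map (Ψ : LocalRingAt p →+* _) := by
    rw [intersectionIdeal, intersectionIdeal, Ideal.map_span, Set.image_insert_eq,
      Set.image_insert_eq, Set.image_singleton]
    simp only [RingEquiv.coe_toRingHom, hΨ]
    rw [twist_of_isHomogeneous hc hf hτf, twist_of_isHomogeneous hc hg hτg,
      chartEquation_twist hc hstar]
    simp only [map_mul (algebraMap _ _), Ideal.span_insert]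
    rw [Ideal.span_singleton_mul_left_unit (hu _ (pow_ne_zero _ (inv_ne_zero hc))),
      Ideal.span_singleton_mul_left_unit (hu _ (pow_ne_zero _ (inv_ne_zero hc))),
      Ideal.span_singleton_mul_left_unit (hu _ (mul_ne_zero (star_ne_zero.2 hc) hc))]
  -- The isomorphism is only `τ`-semilinear, which suffices to preserve dimension.
  refine (Algebra.rank_eq_of_equiv_equiv τ (Ideal.quotientEquiv _ _ Ψ hJ) ?_).symm
  have hL : ∀ (p : Fin 3 → ℂ) (I : Ideal (LocalRingAt p)) (r : ℂ),
      algebraMap ℂ (LocalRingAt p ⧸ I) r =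
        Ideal.Quotient.mk I (algebraMap (MvPolynomial (Fin 3) ℂ) _ (C r)) :=
    fun p I r => rfl
  refine RingHom.ext fun r => ?_
  have h1 := Ideal.quotientEquiv_mk _ _ Ψ hJ (algebraMap (MvPolynomial (Fin 3) ℂ) _ (C r))
  rw [hΨ, twist_C, ← hL, ← hL] at h1
  exact h1.symm

end Semilinear

/-! ### Finiteness of common zeros and of multiplicities -/

section Finiteness

/-- A complex algebra is also a real one, so the real elimination applies directly; coprimality of
the complexified forms is never needed. -/
lemma exists_polynomial_ratio_complexify {f g : MvPolynomial (Fin 3) ℝ} {m n : ℕ}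
    (hfm : f.IsHomogeneous m) (hgn : g.IsHomogeneous n) (h : IsRelPrime f g) (hf : f ≠ 0)
    (i j : Fin 3) :
    ∃ q : Polynomial ℂ, q ≠ 0 ∧ ∀ (B : Type) [CommRing B] [Algebra ℂ B] (b : Fin 3 → B) (y : B),
      aeval b (complexify f) = 0 → aeval b (complexify g) = 0 → b i = b j * y → IsUnit (b j) →
      Polynomial.aeval y q = 0 := by
  obtain ⟨q, hq, hall⟩ := exists_polynomial_ratio hfm hgn h hf i j
  refine ⟨q.map (algebraMap ℝ ℂ), ?_, fun B _ _ b y hbf hbg hy hu => ?_⟩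
  · rwa [Ne, Polynomial.map_eq_zero_iff (algebraMap ℝ ℂ).injective]
  · let _ : Algebra ℝ B := ((algebraMap ℂ B).comp (algebraMap ℝ ℂ)).toAlgebra
    have : IsScalarTower ℝ ℂ B := IsScalarTower.of_algebraMap_eq fun _ => rfl
    rw [Polynomial.aeval_map_algebraMap]
    exact hall B b y (by rwa [complexify, aeval_map_algebraMap] at hbf)
      (by rwa [complexify, aeval_map_algebraMap] at hbg) hy hu

/-- Where coordinate `j` is nonzero, a point is determined by its ratios to that coordinate, and
each ratio is a root of a fixed nonzero polynomial. -/
lemma finite_commonZeros {f g : MvPolynomial (Fin 3) ℝ} {m n : ℕ}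
    (hfm : f.IsHomogeneous m) (hgn : g.IsHomogeneous n) (h : IsRelPrime f g) (hf : f ≠ 0) :
    (complexCurve (complexify f) ∩ complexCurve (complexify g)).Finite := by
  choose q hq hall using exists_polynomial_ratio_complexify hfm hgn h hf
  have hsub : complexCurve (complexify f) ∩ complexCurve (complexify g) ⊆
      ⋃ j, {P | P ∈ complexCurve (complexify f) ∩ complexCurve (complexify g) ∧ P.rep j ≠ 0} := by
    intro P hP
    obtain ⟨j, hj⟩ := Function.ne_iff.1 P.rep_nonzero
    exact Set.mem_iUnion.2 ⟨j, hP, hj⟩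
  refine (Set.finite_iUnion fun j => ?_).subset hsub
  refine Set.Finite.of_injOn (f := fun P i => P.rep i / P.rep j)
    (t := Set.pi Set.univ fun i => {y | Polynomial.aeval y (q i j) = 0}) ?_ ?_ ?_
  · rintro P ⟨⟨hPf, hPg⟩, hj⟩ i -
    refine hall i j ℂ P.rep _ ?_ ?_ (by field_simp) (IsUnit.mk0 _ hj)
    · rw [aeval_eq_eval]; exact hPf
    · rw [aeval_eq_eval]; exact hPg
  · rintro P ⟨-, hP⟩ Q ⟨-, hQ⟩ hPQ
    rw [← P.mk_rep, ← Q.mk_rep, Projectivization.mk_eq_mk_iff']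
    refine ⟨P.rep j / Q.rep j, funext fun i => ?_⟩
    have := congrFun hPQ i
    simp only [Pi.smul_apply, smul_eq_mul] at this ⊢
    field_simp at this ⊢
    linear_combination -this
  · refine Set.Finite.pi fun i => ?_
    refine (q i j).rootSet_finite ℂ |>.subset fun y hy => ?_
    exact (Polynomial.mem_rootSet.2 ⟨hq i j, hy⟩)

/-- Units of an algebra that lie in a finite subalgebra over a field are invertible there. -/
lemma exists_inverse_mem_of_finite {K B : Type*} [Field K] [CommRing B] [Algebra K B]
    (S : Subalgebra K B) [Module.Finite K S] {x : B} (hx : x ∈ S) (hu : IsUnit x) :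
    ∃ y ∈ S, x * y = 1 := by
  have hinj : Function.Injective (LinearMap.mulLeft K (⟨x, hx⟩ : S)) := by
    intro a b hab
    have := congrArg Subtype.val hab
    exact Subtype.ext (hu.mul_left_cancel this)
  obtain ⟨y, hy⟩ := LinearMap.injective_iff_surjective.1 hinj 1
  exact ⟨y, y.2, congrArg Subtype.val hy⟩

lemma isUnit_algebraMap_localRingAt {p : Fin 3 → ℂ} {F : MvPolynomial (Fin 3) ℂ}
    (hF : eval p F ≠ 0) : IsUnit (algebraMap _ (LocalRingAt p) F) :=
  IsLocalization.map_units (LocalRingAt p) (⟨F, hF⟩ : (pointIdeal p).primeCompl)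

/-- The ratios `y i` of `X i` to `X j` are integral, so they generate a finite subalgebra `S`, which
contains the inverse of each of its elements that is a unit of `B`. The chart equation reads `X j *
∑ p̄ᵢ yᵢ = |p|²`, whence `X j ∈ S`. Then all polynomials and all allowed fractions lie in `S`, so `S
= B`. -/
lemma finite_of_ratio {f g : MvPolynomial (Fin 3) ℝ} {m n : ℕ}
    (hfm : f.IsHomogeneous m) (hgn : g.IsHomogeneous n) (h : IsRelPrime f g) (hf : f ≠ 0)
    {p : Fin 3 → ℂ} (hp : p ≠ 0) {B : Type} [CommRing B] [Algebra ℂ B]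
    (θ : MvPolynomial (Fin 3) ℂ →ₐ[ℂ] B) (hθf : θ (complexify f) = 0)
    (hθg : θ (complexify g) = 0) (hθc : θ (chartEquation p) = 0)
    (hunit : ∀ F, eval p F ≠ 0 → IsUnit (θ F))
    (hsurj : ∀ x : B, ∃ a s, eval p s ≠ 0 ∧ x * θ s = θ a) :
    Module.Finite ℂ B := by
  choose q hq hall using exists_polynomial_ratio_complexify hfm hgn h hf
  obtain ⟨j, hj⟩ := Function.ne_iff.1 hp
  have hae : ∀ F, aeval (fun i => θ (X i)) F = θ F := fun F =>
    DFunLike.congr_fun (algHom_ext (f := aeval fun i => θ (X i)) (g := θ) fun i => by simp) F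
  have hjU : IsUnit (θ (X j)) := hunit _ (by simpa using hj)
  obtain ⟨w, hw⟩ := hjU.exists_right_inv
  obtain ⟨y, hxy⟩ : ∃ y : Fin 3 → B, ∀ i, θ (X i) = θ (X j) * y i :=
    ⟨fun i => w * θ (X i), fun i => by simp only; rw [← mul_assoc, hw, one_mul]⟩
  have hint : ∀ i, IsIntegral ℂ (y i) := fun i => by
    rw [← isAlgebraic_iff_isIntegral]
    exact ⟨q i j, hq i j, hall i j _ (fun i => θ (X i)) _ (by rw [hae, hθf])
      (by rw [hae, hθg]) (hxy i) hjU⟩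
  set S := Algebra.adjoin ℂ (Set.range y) with hS
  have hSfin : Module.Finite ℂ S := by
    refine Algebra.finite_adjoin_of_finite_of_isIntegral (Set.finite_range y) ?_
    rintro _ ⟨i, rfl⟩
    exact hint i
  have hyS : ∀ i, y i ∈ S := fun i => Algebra.subset_adjoin ⟨i, rfl⟩
  have hchart : θ (X j) * ∑ i, algebraMap ℂ B (star (p i)) * y i =
      algebraMap ℂ B (∑ i, star (p i) * p i) := by
    have h2 : ∀ r, θ (C r) = algebraMap ℂ B r := fun r => θ.commutes r
    simp only [chartEquation, map_sum, map_mul, map_sub, h2, mul_sub, Finset.sum_sub_distrib,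
      sub_eq_zero] at hθc
    rw [map_sum, Finset.mul_sum]
    simp only [map_mul]
    rw [← hθc]
    refine Finset.sum_congr rfl fun i _ => ?_
    rw [hxy i]; ring
  have hnorm : ∑ i, star (p i) * p i ≠ 0 := by
    have h1 : ∑ i, star (p i) * p i = ((∑ i, Complex.normSq (p i) : ℝ) : ℂ) := by
      rw [Complex.ofReal_sum]
      exact Finset.sum_congr rfl fun i _ => (Complex.normSq_eq_conj_mul_self).symm
    rw [h1, Complex.ofReal_ne_zero]
    exact (Finset.sum_pos' (fun i _ => Complex.normSq_nonneg _)
      ⟨j, Finset.mem_univ j, Complex.normSq_pos.2 hj⟩).ne'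
  have hjS : θ (X j) ∈ S := by
    have hzU : IsUnit (∑ i, algebraMap ℂ B (star (p i)) * y i) :=
      isUnit_of_mul_isUnit_right (hchart ▸ (IsUnit.mk0 _ hnorm).map (algebraMap ℂ B))
    obtain ⟨z, hz, hz1⟩ := exists_inverse_mem_of_finite S
      (sum_mem fun i _ => mul_mem (S.algebraMap_mem _) (hyS i)) hzU
    have : θ (X j) = algebraMap ℂ B (∑ i, star (p i) * p i) * z := by
      rw [← hchart, mul_assoc, hz1, mul_one]
    rw [this]
    exact mul_mem (S.algebraMap_mem _) hz
  have hθS : ∀ F, θ F ∈ S := fun F => by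
    rw [← hae, aeval_def, eval₂_eq]
    refine sum_mem fun a _ => mul_mem (S.algebraMap_mem _) (prod_mem fun i _ => pow_mem ?_ _)
    rw [hxy]
    exact mul_mem hjS (hyS i)
  have htop : S = ⊤ := by
    refine Algebra.eq_top_iff.2 fun x => ?_
    obtain ⟨a, s, hs, has⟩ := hsurj x
    obtain ⟨z, hz, hz1⟩ := exists_inverse_mem_of_finite S (hθS s) (hunit _ hs)
    have : x = θ a * z := by rw [← has, mul_assoc, hz1, mul_one]
    rw [this]
    exact mul_mem (hθS a) hz
  clear_value S
  subst htop
  exact Module.Finite.equiv (Subalgebra.topEquiv (R := ℂ) (A := B)).toLinearEquiv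

lemma finite_quotient_intersectionIdeal {f g : MvPolynomial (Fin 3) ℝ} {m n : ℕ}
    (hfm : f.IsHomogeneous m) (hgn : g.IsHomogeneous n) (h : IsRelPrime f g) (hf : f ≠ 0)
    {p : Fin 3 → ℂ} (hp : p ≠ 0) :
    Module.Finite ℂ
      (LocalRingAt p ⧸ intersectionIdeal (complexify f) (complexify g) p) := by
  obtain ⟨θ, hθ⟩ : ∃ θ : MvPolynomial (Fin 3) ℂ →ₐ[ℂ]
      LocalRingAt p ⧸ intersectionIdeal (complexify f) (complexify g) p,
      ∀ F, θ F = Ideal.Quotient.mk _ (algebraMap _ (LocalRingAt p) F) :=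
    ⟨(Ideal.Quotient.mkₐ ℂ _).comp (IsScalarTower.toAlgHom ℂ _ (LocalRingAt p)), fun _ => rfl⟩
  have hmem : ∀ F : MvPolynomial (Fin 3) ℂ, algebraMap _ (LocalRingAt p) F ∈
      intersectionIdeal (complexify f) (complexify g) p → θ F = 0 := fun F hF => by
    rw [hθ]; exact Ideal.Quotient.eq_zero_iff_mem.2 hF
  refine finite_of_ratio
    (B := LocalRingAt p ⧸ intersectionIdeal (complexify f) (complexify g) p) hfm hgn h hf hp θ
    (hmem (complexify f) (Ideal.subset_span (Set.mem_insert _ _)))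
    (hmem (complexify g) (Ideal.subset_span (Set.mem_insert_of_mem _ (Set.mem_insert _ _))))
    (hmem (chartEquation p) (Ideal.subset_span
      (Set.mem_insert_of_mem _ (Set.mem_insert_of_mem _ rfl))))
    (fun F hF => ?_) fun x => ?_
  · rw [hθ]
    exact (isUnit_algebraMap_localRingAt hF).map (Ideal.Quotient.mk _)
  · obtain ⟨x, rfl⟩ := Ideal.Quotient.mk_surjective x
    obtain ⟨⟨a, s⟩, has⟩ := IsLocalization.surj (pointIdeal p).primeCompl x
    refine ⟨a, s, s.2, ?_⟩
    rw [hθ, hθ, ← map_mul]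
    exact congrArg (Ideal.Quotient.mk _) has

end Finiteness

/-! ### Local rings with principal maximal ideal -/

section LocalRing

variable {K R : Type*} [Field K] [CommRing R] [IsLocalRing R] [Algebra K R] {π : R}

/-- In a local ring with residue field `K` and maximal ideal `(π)`, `K[π]` approximates every
element to any order. -/
lemma exists_polynomial_sub_mem (hπ : IsLocalRing.maximalIdeal R = Ideal.span {π})
    (hK : ∀ x : R, ∃ c : K, x - algebraMap K R c ∈ IsLocalRing.maximalIdeal R) (k : ℕ) (x : R) :
    ∃ P : Polynomial K, x - Polynomial.aeval π P ∈ Ideal.span {π ^ k} := by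
  induction k with
  | zero => exact ⟨0, by simp⟩
  | succ k ih =>
    obtain ⟨P, hP⟩ := ih
    obtain ⟨y, hy⟩ := Ideal.mem_span_singleton'.1 hP
    obtain ⟨c, hc⟩ := hK y
    rw [hπ] at hc
    obtain ⟨z, hz⟩ := Ideal.mem_span_singleton'.1 hc
    refine ⟨P + Polynomial.C c * Polynomial.X ^ k, Ideal.mem_span_singleton'.2 ⟨z, ?_⟩⟩
    simp only [map_add, map_mul, map_pow, Polynomial.aeval_C, Polynomial.aeval_X]
    linear_combination hy + π ^ k * hz

/-- Write `P = X ^ j * Q` with `Q(0) ≠ 0`, so that `Q(π)` is a unit. If `j < k`, membership makes `π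
^ j` times a unit vanish, contrary to `hnil`. -/
lemma X_pow_dvd_of_aeval_mem (hπ : IsLocalRing.maximalIdeal R = Ideal.span {π})
    (hnil : ∀ k, π ^ k ≠ 0) (k : ℕ) {P : Polynomial K}
    (hP : Polynomial.aeval π P ∈ Ideal.span {π ^ k}) : Polynomial.X ^ k ∣ P := by
  have hπm : π ∈ IsLocalRing.maximalIdeal R := hπ ▸ Ideal.mem_span_singleton_self π
  by_cases h0 : P = 0
  · simp [h0]
  obtain ⟨Q, hQ, hX⟩ := Polynomial.exists_eq_pow_rootMultiplicity_mul_and_not_dvd P h0 0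
  set j := P.rootMultiplicity 0
  rw [Polynomial.C_0, sub_zero] at hQ hX
  by_contra hdvd
  have hjk : j < k := by
    by_contra! h
    exact hdvd (hQ ▸ (pow_dvd_pow _ h).mul_right _)
  have hQu : IsUnit (Polynomial.aeval π Q) := by
    rw [← Q.divX_mul_X_add]
    have hc : Q.coeff 0 ≠ 0 := fun h => hX (Polynomial.X_dvd_iff.2 h)
    by_contra hnu
    have h1 : Polynomial.aeval π (Q.divX * Polynomial.X + Polynomial.C (Q.coeff 0)) ∈
        IsLocalRing.maximalIdeal R := hnu
    have h2 : algebraMap K R (Q.coeff 0) ∈ IsLocalRing.maximalIdeal R := by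
      have := Ideal.sub_mem _ h1
        (Ideal.mul_mem_left _ (Polynomial.aeval π Q.divX) hπm)
      simpa using this
    exact h2 ((IsUnit.mk0 _ hc).map (algebraMap K R))
  obtain ⟨y, hy⟩ := Ideal.mem_span_singleton'.1 hP
  obtain ⟨l, rfl⟩ := Nat.exists_eq_add_of_lt hjk
  rw [hQ, map_mul, map_pow, Polynomial.aeval_X] at hy
  have hu : IsUnit (Polynomial.aeval π Q - y * π ^ (l + 1)) := by
    by_contra hnu
    have h1 : Polynomial.aeval π Q - y * π ^ (l + 1) ∈ IsLocalRing.maximalIdeal R := hnu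
    have h2 := Ideal.add_mem _ h1
      (Ideal.mul_mem_left _ y (Ideal.pow_mem_of_mem _ hπm (l + 1) (by omega)))
    rw [sub_add_cancel] at h2
    exact h2 hQu
  have h3 : π ^ j * (Polynomial.aeval π Q - y * π ^ (l + 1)) = 0 := by
    linear_combination -hy
  exact hnil j ((hu.mul_left_eq_zero).1 h3)

/-- Evaluation at `π` identifies `K[X] / (X ^ k)` with `R / (π ^ k)`: approximation gives
surjectivity, `X_pow_dvd_of_aeval_mem` the kernel. -/
lemma toENat_rank_quotient_pow (hπ : IsLocalRing.maximalIdeal R = Ideal.span {π})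
    (hK : ∀ x : R, ∃ c : K, x - algebraMap K R c ∈ IsLocalRing.maximalIdeal R)
    (hnil : ∀ k, π ^ k ≠ 0) (k : ℕ) :
    Cardinal.toENat (Module.rank K (R ⧸ Ideal.span {π ^ k})) = k := by
  let φ : Polynomial K →ₐ[K] R ⧸ Ideal.span {π ^ k} :=
    (Ideal.Quotient.mkₐ K (Ideal.span {π ^ k})).comp (Polynomial.aeval π)
  have hφ : Function.Surjective φ := by
    intro x
    obtain ⟨x, rfl⟩ := Ideal.Quotient.mk_surjective x
    obtain ⟨P, hP⟩ := exists_polynomial_sub_mem hπ hK k x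
    exact ⟨P, (Ideal.Quotient.eq.2 hP).symm⟩
  have hker : RingHom.ker φ = Ideal.span {Polynomial.X ^ k} := by
    ext P
    rw [RingHom.mem_ker, Ideal.mem_span_singleton]
    change Ideal.Quotient.mk _ (Polynomial.aeval π P) = 0 ↔ _
    rw [Ideal.Quotient.eq_zero_iff_mem]
    refine ⟨X_pow_dvd_of_aeval_mem hπ hnil k, ?_⟩
    rintro ⟨Q, rfl⟩
    rw [map_mul, map_pow, Polynomial.aeval_X]
    exact Ideal.mul_mem_right _ _ (Ideal.mem_span_singleton_self _)
  have e1 := ((Ideal.quotientEquivAlgOfEq K hker).symm.trans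
    (Ideal.quotientKerAlgEquivOfSurjective hφ)).toLinearEquiv
  have : Module.Finite K (Polynomial K ⧸ Ideal.span {(Polynomial.X : Polynomial K) ^ k}) :=
    (Polynomial.monic_X_pow k).finite_quotient
  have := Module.Finite.equiv e1
  rw [← Module.finrank_eq_rank, ← e1.finrank_eq, finrank_quotient_span_eq_natDegree]
  simp

/-- An element of a Noetherian local ring with principal maximal ideal `(π)` and quotient of
dimension `n` is associated to `π ^ n`. -/
lemma exists_unit_mul_pow_of_rank_quotient [IsNoetherianRing R]
    (hπ : IsLocalRing.maximalIdeal R = Ideal.span {π})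
    (hK : ∀ x : R, ∃ c : K, x - algebraMap K R c ∈ IsLocalRing.maximalIdeal R)
    (hnil : ∀ k, π ^ k ≠ 0) {g : R} {n : ℕ}
    (hn : Cardinal.toENat (Module.rank K (R ⧸ Ideal.span {g})) = n) :
    ∃ u : R, IsUnit u ∧ g = u * π ^ n := by
  -- If `g` were divisible by all powers of `π`, the `n`-dimensional `R / (g)` would surject onto `R
  -- / (π ^ (n + 1))`, of dimension `n + 1`.
  by_cases hg : ∀ k, g ∈ Ideal.span {π ^ k}
  · exfalso
    have hle : Ideal.span {g} ≤ Ideal.span {π ^ (n + 1)} :=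
      (Ideal.span_singleton_le_iff_mem _).2 (hg _)
    have h1 := LinearMap.rank_le_of_surjective
      (Ideal.Quotient.factorₐ K hle).toLinearMap (Ideal.Quotient.factor_surjective hle)
    have h2 := Cardinal.toENat.monotone' h1
    change Cardinal.toENat _ ≤ Cardinal.toENat _ at h2
    rw [hn, toENat_rank_quotient_pow hπ hK hnil] at h2
    have : n + 1 ≤ n := by exact_mod_cast h2
    omega
  · push Not at hg
    classical
    obtain ⟨k, hk, hk'⟩ : ∃ k, g ∈ Ideal.span {π ^ k} ∧ g ∉ Ideal.span {π ^ (k + 1)} := by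
      have hpos : Nat.find hg ≠ 0 := fun h => by
        have := Nat.find_spec hg
        rw [h] at this
        simp at this
      obtain ⟨k, hk⟩ := Nat.exists_eq_succ_of_ne_zero hpos
      refine ⟨k, by_contra fun h => Nat.find_min hg (m := k) (by omega) h, ?_⟩
      have := Nat.find_spec hg
      rwa [hk] at this
    obtain ⟨u, hu⟩ := Ideal.mem_span_singleton'.1 hk
    have huu : IsUnit u := by
      by_contra hnu
      have h1 : u ∈ IsLocalRing.maximalIdeal R := hnu
      rw [hπ] at h1
      obtain ⟨v, hv⟩ := Ideal.mem_span_singleton'.1 h1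
      exact hk' (Ideal.mem_span_singleton'.2 ⟨v, by rw [← hu, ← hv]; ring⟩)
    have hspan : Ideal.span {g} = Ideal.span {π ^ k} := by
      rw [← hu]; exact Ideal.span_singleton_mul_left_unit huu _
    rw [hspan, toENat_rank_quotient_pow hπ hK hnil] at hn
    obtain rfl : k = n := by exact_mod_cast hn
    exact ⟨u, huu, hu.symm⟩

end LocalRing

/-! ### Passage to the local ring of the curve -/

section Quotient

variable {K O : Type*} [Field K] [CommRing O] [IsLocalRing O] [IsNoetherianRing O] [Algebra K O]

/-- A version of `exists_unit_mul_pow_of_rank_quotient` for congruences modulo an ideal `J`. -/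
lemma exists_unit_sub_mem_of_rank_quotient {J : Ideal O} {π g : O}
    (hJ : J ≤ IsLocalRing.maximalIdeal O) (hπ : π ∈ IsLocalRing.maximalIdeal O)
    (hmax : IsLocalRing.maximalIdeal O ≤ J ⊔ Ideal.span {π})
    (hK : ∀ x : O, ∃ c : K, x - algebraMap K O c ∈ IsLocalRing.maximalIdeal O)
    (hnil : ∀ k, π ^ k ∉ J) {n : ℕ}
    (hn : Cardinal.toENat (Module.rank K (O ⧸ J ⊔ Ideal.span {g})) = n) :
    ∃ r : O, IsUnit r ∧ g - r * π ^ n ∈ J := by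
  have hJtop : J ≠ ⊤ := fun h => hnil 0 (h ▸ Submodule.mem_top)
  have hnt : Nontrivial (O ⧸ J) := Ideal.Quotient.nontrivial_iff.2 hJtop
  have hloc : IsLocalRing (O ⧸ J) :=
    IsLocalRing.of_surjective' (Ideal.Quotient.mk J) Ideal.Quotient.mk_surjective
  have hmem : ∀ x : O, Ideal.Quotient.mk J x ∈ IsLocalRing.maximalIdeal (O ⧸ J) ↔
      x ∈ IsLocalRing.maximalIdeal O := by
    refine fun x => ⟨fun hx hu => hx (hu.map _), fun hx hu => ?_⟩
    obtain ⟨y, hy⟩ := hu.exists_right_inv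
    obtain ⟨y, rfl⟩ := Ideal.Quotient.mk_surjective y
    rw [← map_mul, ← map_one (Ideal.Quotient.mk J), Ideal.Quotient.eq] at hy
    have h1 := Ideal.sub_mem _ (Ideal.mul_mem_right y _ hx) (hJ hy)
    rw [sub_sub_cancel] at h1
    exact h1 isUnit_one
  have hmaxR : IsLocalRing.maximalIdeal (O ⧸ J) = Ideal.span {Ideal.Quotient.mk J π} := by
    apply le_antisymm
    · intro x hx
      obtain ⟨x, rfl⟩ := Ideal.Quotient.mk_surjective x
      obtain ⟨y, hy, z, hz, rfl⟩ := Submodule.mem_sup.1 (hmax ((hmem x).1 hx))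
      rw [map_add, Ideal.Quotient.eq_zero_iff_mem.2 hy, zero_add]
      obtain ⟨w, rfl⟩ := Ideal.mem_span_singleton'.1 hz
      rw [map_mul]
      exact Ideal.mul_mem_left _ _ (Ideal.mem_span_singleton_self _)
    · rw [Ideal.span_singleton_le_iff_mem]
      exact (hmem π).2 hπ
  have hnil' : ∀ k, Ideal.Quotient.mk J π ^ k ≠ 0 := by
    intro k
    rw [← map_pow, Ne, Ideal.Quotient.eq_zero_iff_mem]
    exact hnil k
  have hres : ∀ x : O ⧸ J, ∃ c : K, x - algebraMap K (O ⧸ J) c ∈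
      IsLocalRing.maximalIdeal (O ⧸ J) := by
    intro x
    obtain ⟨x, rfl⟩ := Ideal.Quotient.mk_surjective x
    obtain ⟨c, hc⟩ := hK x
    exact ⟨c, (hmem _).2 hc⟩
  have h1 : (Ideal.span {g}).map (Ideal.Quotient.mkₐ K J) =
      Ideal.span {Ideal.Quotient.mk J g} := by
    rw [Ideal.map_span, Set.image_singleton]; rfl
  -- The quotient by `J ⊔ (g)` is computed in two stages, `(O / J) / (g)`.
  have e := ((Ideal.quotientEquivAlgOfEq K h1).symm.trans
    (DoubleQuot.quotQuotEquivQuotSupₐ K J (Ideal.span {g}))).toLinearEquiv.rank_eq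
  rw [← e] at hn
  obtain ⟨r, hr, hg⟩ := exists_unit_mul_pow_of_rank_quotient hmaxR hres hnil' hn
  obtain ⟨r, rfl⟩ := Ideal.Quotient.mk_surjective r
  refine ⟨r, ?_, ?_⟩
  · by_contra hnu
    exact (hmem r).2 hnu hr
  · rw [← Ideal.Quotient.eq, hg, map_mul, map_pow]

end Quotient

/-! ### First-order expansion at a point -/

section Taylor

variable {σ k : Type*} [Fintype σ] [Field k]

/-- First-order Taylor expansion. -/
lemma taylor_mem (p : σ → k) (F : MvPolynomial σ k) :
    F - C (eval p F) ∈ Ideal.span (Set.range fun i => X i - C (p i)) ∧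
    F - C (eval p F) - ∑ i, C (eval p (pderiv i F)) * (X i - C (p i)) ∈
      Ideal.span (Set.range fun i => X i - C (p i)) ^ 2 := by
  classical
  set I := Ideal.span (Set.range fun i : σ => (X i - C (p i) : MvPolynomial σ k)) with hI
  have hX : ∀ i, X i - C (p i) ∈ I := fun i => Ideal.subset_span ⟨i, rfl⟩
  have hlin : ∀ F, ∑ i, C (eval p (pderiv i F)) * (X i - C (p i)) ∈ I := fun F =>
    Ideal.sum_mem _ fun i _ => I.mul_mem_left _ (hX i)
  have h2 : ∀ F, F - C (eval p F) - ∑ i, C (eval p (pderiv i F)) * (X i - C (p i)) ∈ I ^ 2 := by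
    intro F
    induction F using MvPolynomial.induction_on with
    | C r => simp
    | add F G hF hG =>
      convert Ideal.add_mem _ hF hG using 1
      simp only [map_add, add_mul, Finset.sum_add_distrib]
      ring
    | mul_X F j hF =>
      have h3 : ∑ i, C (eval p (pderiv i (F * X j))) * (X i - C (p i)) =
          C (p j) * (∑ i, C (eval p (pderiv i F)) * (X i - C (p i))) +
            C (eval p F) * (X j - C (p j)) := by
        simp only [Derivation.leibniz, smul_eq_mul, map_add, map_mul, eval_X, add_mul,
          Finset.sum_add_distrib, Finset.mul_sum]
        rw [add_comm]
        congr 1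
        · exact Finset.sum_congr rfl fun i _ => by ring
        · rw [Finset.sum_eq_single j]
          · simp
          · intro i _ hi
            rw [pderiv_X_of_ne hi.symm]; simp
          · simp
      rw [h3]
      convert Ideal.add_mem _ (Ideal.mul_mem_left _ (X j) hF)
        (by rw [pow_two]; exact Ideal.mul_mem_mul (hlin F) (hX j)) using 1
      simp only [map_mul, eval_X]
      ring
  refine ⟨?_, h2 F⟩
  have := Ideal.add_mem _ (Ideal.pow_le_self two_ne_zero (h2 F)) (hlin F)
  simpa using this

end Taylor

/-! ### An orthogonal frame at a real point -/

section Frame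

/-- Two orthogonal nonzero vectors in space extend to an orthogonal basis. -/
lemma exists_orthogonal_frame {v N : Fin 3 → ℝ} (hv : v ≠ 0) (hN : N ≠ 0)
    (hvN : ∑ i, v i * N i = 0) :
    0 < ∑ i, v i ^ 2 ∧ 0 < ∑ i, N i ^ 2 ∧
    ∃ u : Fin 3 → ℝ, 0 < ∑ i, u i ^ 2 ∧ ∑ i, v i * u i = 0 ∧ ∑ i, u i * N i = 0 ∧
      ∀ i j, v i * v j * ∑ k, N k ^ 2 + N i * N j * ∑ k, v k ^ 2 + u i * u j =
        if i = j then (∑ k, v k ^ 2) * ∑ k, N k ^ 2 else 0 := by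
  have hpos : ∀ w : Fin 3 → ℝ, w ≠ 0 → 0 < ∑ i, w i ^ 2 := fun w hw => by
    obtain ⟨j, hj⟩ := Function.ne_iff.1 hw
    exact Finset.sum_pos' (fun i _ => sq_nonneg _) ⟨j, Finset.mem_univ j, sq_pos_iff.2 hj⟩
  -- The third vector is the cross product `v × N`, with `|u|² = |v|² |N|²`; this makes the frame
  -- identity a resolution of the identity matrix scaled by `|v|² |N|²`.
  refine ⟨hpos v hv, hpos N hN, ![v 1 * N 2 - v 2 * N 1, v 2 * N 0 - v 0 * N 2,
    v 0 * N 1 - v 1 * N 0], ?_, ?_, ?_, ?_⟩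
  · have := mul_pos (hpos v hv) (hpos N hN)
    simp only [Fin.sum_univ_three] at hvN this ⊢
    simp
    have h2 : (v 1 * N 2 - v 2 * N 1) ^ 2 + (v 2 * N 0 - v 0 * N 2) ^ 2 +
        (v 0 * N 1 - v 1 * N 0) ^ 2 =
        (v 0 ^ 2 + v 1 ^ 2 + v 2 ^ 2) * (N 0 ^ 2 + N 1 ^ 2 + N 2 ^ 2) := by
      linear_combination -(v 0 * N 0 + v 1 * N 1 + v 2 * N 2) * hvN
    rw [h2]; exact this
  · simp [Fin.sum_univ_three]; ring
  · simp [Fin.sum_univ_three]; ring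
  · intro i j
    simp only [Fin.sum_univ_three] at hvN ⊢
    fin_cases i <;> fin_cases j <;> simp
    · linear_combination (v 0 * N 0 + v 0 * N 0 - (v 0 * N 0 + v 1 * N 1 + v 2 * N 2)) * hvN
    · linear_combination (v 0 * N 1 + v 1 * N 0) * hvN
    · linear_combination (v 0 * N 2 + v 2 * N 0) * hvN
    · linear_combination (v 0 * N 1 + v 1 * N 0) * hvN
    · linear_combination (v 1 * N 1 + v 1 * N 1 - (v 0 * N 0 + v 1 * N 1 + v 2 * N 2)) * hvN
    · linear_combination (v 1 * N 2 + v 2 * N 1) * hvN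
    · linear_combination (v 0 * N 2 + v 2 * N 0) * hvN
    · linear_combination (v 1 * N 2 + v 2 * N 1) * hvN
    · linear_combination (v 2 * N 2 + v 2 * N 2 - (v 0 * N 0 + v 1 * N 1 + v 2 * N 2)) * hvN

end Frame

/-! ### Real points of the curve near a smooth point -/

section RealPoints

variable {σ : Type*} [Fintype σ]

/-- Near a zero `v` of `F` at which the derivative in direction `N` does not vanish, there are zeros of
`F` in the plane `v + ⟨N, u⟩` with positive second coordinate. -/
lemma frequently_zero_pos {F : MvPolynomial σ ℝ} {v N : σ → ℝ} (hF : eval v F = 0)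
    (hN : 0 < eval v (directionalDeriv N F)) (u : σ → ℝ) :
    ∃ᶠ x : ℝ × ℝ in nhds 0, eval (fun i => v i + x.1 * N i + x.2 * u i) F = 0 ∧ 0 < x.2 := by
  obtain ⟨G, hG0, hG⟩ := exists_eval_line_eq F v N
  have hGpos : ∀ᶠ t in nhds (0 : ℝ), 0 < G.eval t := by
    refine (G.continuous.tendsto 0).eventually_const_lt ?_
    rw [hG0]; exact hN
  obtain ⟨δ, hδ, hδG⟩ := Metric.eventually_nhds_iff.1 hGpos
  rw [Metric.nhds_basis_ball.frequently_iff]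
  intro ε hε
  obtain ⟨t, htpos, ht⟩ := exists_between (lt_min hε hδ)
  have htε : t < ε := ht.trans_le (min_le_left _ _)
  have htδ : t < δ := ht.trans_le (min_le_right _ _)
  have hG1 : 0 < G.eval t := hδG (by simpa [abs_of_pos htpos] using htδ)
  have hG2 : 0 < G.eval (-t) := hδG (by simpa [abs_of_pos htpos] using htδ)
  have hval : ∀ s, eval (fun i => v i + s * N i + 0 * u i) F = s * G.eval s := fun s => by
    have := hG s
    rw [hF, zero_add] at this
    simpa using this
  -- At `s = 0`, `F` is positive at `t` and negative at `-t` in direction `N`. Both signs persist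
  -- for small `s > 0`, and the intermediate value theorem gives a zero between.
  have h1 : ∀ᶠ s in nhdsWithin (0 : ℝ) (Set.Ioi 0),
      0 < eval (fun i => v i + t * N i + s * u i) F := by
    have hc : Continuous fun s : ℝ => eval (fun i => v i + t * N i + s * u i) F :=
      (continuous_eval F).comp (by fun_prop)
    refine ((hc.tendsto 0).eventually_const_lt ?_).filter_mono nhdsWithin_le_nhds
    rw [hval]; exact mul_pos htpos hG1
  have h2 : ∀ᶠ s in nhdsWithin (0 : ℝ) (Set.Ioi 0),
      eval (fun i => v i + (-t) * N i + s * u i) F < 0 := by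
    have hc : Continuous fun s : ℝ => eval (fun i => v i + (-t) * N i + s * u i) F :=
      (continuous_eval F).comp (by fun_prop)
    refine ((hc.tendsto 0).eventually_lt_const ?_).filter_mono nhdsWithin_le_nhds
    rw [hval]; linarith [mul_pos htpos hG2]
  have h3 : ∀ᶠ s in nhdsWithin (0 : ℝ) (Set.Ioi 0), s < ε :=
    ((continuous_id.tendsto (0 : ℝ)).eventually_lt_const hε).filter_mono nhdsWithin_le_nhds
  obtain ⟨s, hs1, hs2, hs3, hs⟩ := (h1.and (h2.and (h3.and self_mem_nhdsWithin))).exists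
  replace hs : 0 < s := hs
  have hc : Continuous fun r : ℝ => eval (fun i => v i + r * N i + s * u i) F :=
    (continuous_eval F).comp (by fun_prop)
  obtain ⟨r, ⟨hr1, hr2⟩, hr⟩ := intermediate_value_Icc (by linarith : -t ≤ t) hc.continuousOn
    (⟨hs2.le, hs1.le⟩ : (0 : ℝ) ∈ Set.Icc _ _)
  refine ⟨(r, s), ?_, hr, hs⟩
  rw [mem_ball_zero_iff, Prod.norm_def, max_lt_iff]
  simp only [Real.norm_eq_abs]
  exact ⟨abs_lt.2 ⟨by linarith, by linarith⟩, by rwa [abs_of_pos hs]⟩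

end RealPoints

/-! ### The uniformizer at a smooth real point -/

section Branch

lemma eval_complexify (F : MvPolynomial (Fin 3) ℝ) (v : Fin 3 → ℝ) :
    eval (fun i => (v i : ℂ)) (complexify F) = (eval v F : ℝ) := by
  rw [complexify, eval_map]
  exact (hom_eval₂ F (RingHom.id ℝ) (algebraMap ℝ ℂ) v).symm

/-- Congruences in the local ring give identities of values on the curve. -/
lemma exists_eval_mul_eq {p : Fin 3 → ℂ} {G Q c₁ c₂ : MvPolynomial (Fin 3) ℂ} {r : LocalRingAt p}
    (h : algebraMap _ (LocalRingAt p) G - r * algebraMap _ _ Q ∈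
      Ideal.span {algebraMap _ (LocalRingAt p) c₁, algebraMap _ (LocalRingAt p) c₂}) :
    ∃ D N : MvPolynomial (Fin 3) ℂ, eval p D ≠ 0 ∧ (IsUnit r → eval p N ≠ 0) ∧
      ∀ q, eval q c₁ = 0 → eval q c₂ = 0 → eval q D * eval q G = eval q N * eval q Q := by
  obtain ⟨a, b, hab⟩ := Ideal.mem_span_pair.1 h
  obtain ⟨⟨a', s⟩, ha⟩ := IsLocalization.surj (pointIdeal p).primeCompl a
  obtain ⟨⟨b', t⟩, hb⟩ := IsLocalization.surj (pointIdeal p).primeCompl b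
  obtain ⟨⟨r', w⟩, hr⟩ := IsLocalization.surj (pointIdeal p).primeCompl r
  simp only at ha hb hr
  have hs : eval p (s : MvPolynomial (Fin 3) ℂ) ≠ 0 := s.2
  have ht : eval p (t : MvPolynomial (Fin 3) ℂ) ≠ 0 := t.2
  have hw : eval p (w : MvPolynomial (Fin 3) ℂ) ≠ 0 := w.2
  refine ⟨s * t * w, s * t * r', by simp [hs, ht, hw], fun hu => ?_, fun q h1 h2 => ?_⟩
  · have h3 : IsUnit (algebraMap _ (LocalRingAt p) r') :=
      hr ▸ hu.mul (IsLocalization.map_units _ w)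
    have h4 := (IsLocalization.AtPrime.isUnit_to_map_iff (LocalRingAt p) (pointIdeal p) r').1 h3
    have h5 : eval p r' ≠ 0 := h4
    simp [hs, ht, h5]
  · have hinj : Function.Injective (algebraMap (MvPolynomial (Fin 3) ℂ) (LocalRingAt p)) :=
      IsLocalization.injective _ (pointIdeal p).primeCompl_le_nonZeroDivisors
    have h3 : (s * t * w : MvPolynomial (Fin 3) ℂ) * G - s * t * r' * Q =
        a' * t * w * c₁ + b' * s * w * c₂ := by
      apply hinj
      simp only [map_sub, map_add, map_mul, ← ha, ← hb, ← hr]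
      linear_combination -(algebraMap _ (LocalRingAt p) (s : MvPolynomial (Fin 3) ℂ) *
        algebraMap _ (LocalRingAt p) (t : MvPolynomial (Fin 3) ℂ) *
        algebraMap _ (LocalRingAt p) (w : MvPolynomial (Fin 3) ℂ)) * hab
    have h4 := congrArg (eval q) h3
    simp only [map_sub, map_add, map_mul, h1, h2, mul_zero, add_zero, sub_eq_zero] at h4
    simpa using h4

/-- The affine linear form with real gradient `u` vanishing at `v`. -/
def linearFormAt (u v : Fin 3 → ℝ) : MvPolynomial (Fin 3) ℂ :=
  ∑ i, C (u i : ℂ) * (X i - C (v i : ℂ))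

lemma chartEquation_ofReal (v : Fin 3 → ℝ) :
    chartEquation (fun i => (v i : ℂ)) = linearFormAt v v := by
  simp [chartEquation, linearFormAt]

lemma eval_linearFormAt (u v w : Fin 3 → ℝ) :
    eval (fun i => ((v i + w i : ℝ) : ℂ)) (linearFormAt u v) = ((∑ i, u i * w i : ℝ) : ℂ) := by
  simp [linearFormAt]

lemma pointIdeal_eq_span (p : Fin 3 → ℂ) :
    pointIdeal p = Ideal.span (Set.range fun i => X i - C (p i)) := by
  apply le_antisymm
  · intro F hF
    have := (taylor_mem p F).1
    rw [pointIdeal, RingHom.mem_ker] at hF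
    simpa [hF] using this
  · rw [Ideal.span_le]
    rintro _ ⟨i, rfl⟩
    simp [pointIdeal]

/-- At a smooth real point the curve has a uniformizer that is linear in the chart. -/
lemma maximalIdeal_le {f : MvPolynomial (Fin 3) ℝ} {v u : Fin 3 → ℝ} (hfv : eval v f = 0)
    {N : Fin 3 → ℝ} (hN : ∀ i, N i = eval v (pderiv i f))
    {A B K : ℝ} (hK : K ≠ 0)
    (hframe : ∀ i j, v i * v j * A + N i * N j * B + u i * u j = if i = j then K else 0) :
    IsLocalRing.maximalIdeal (LocalRingAt fun i => (v i : ℂ)) ≤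
      Ideal.span {algebraMap _ _ (complexify f), algebraMap _ _ (linearFormAt v v)} ⊔
        Ideal.span {algebraMap _ _ (linearFormAt u v)} := by
  set p : Fin 3 → ℂ := fun i => (v i : ℂ) with hp
  have hpoly : pointIdeal p ≤
      (Ideal.span {complexify f, linearFormAt v v} ⊔ Ideal.span {linearFormAt u v}) ⊔
        pointIdeal p ^ 2 := by
    conv_lhs => rw [pointIdeal_eq_span]
    rw [Ideal.span_le]
    rintro _ ⟨i, rfl⟩
    set I := (Ideal.span {complexify f, linearFormAt v v} ⊔ Ideal.span {linearFormAt u v}) ⊔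
        pointIdeal p ^ 2 with hI
    have h1 : linearFormAt v v ∈ I :=
      Ideal.mem_sup_left (Ideal.mem_sup_left (Ideal.subset_span (by simp)))
    have h2 : linearFormAt u v ∈ I :=
      Ideal.mem_sup_left (Ideal.mem_sup_right (Ideal.subset_span (by simp)))
    have h3 : complexify f ∈ I :=
      Ideal.mem_sup_left (Ideal.mem_sup_left (Ideal.subset_span (by simp)))
    -- Modulo the square of the maximal ideal, `f` is its differential at `v`.
    have h4 : linearFormAt N v ∈ I := by
      have h5 := (taylor_mem p (complexify f)).2
      rw [← pointIdeal_eq_span] at h5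
      have h6 := I.sub_mem h3 (show _ ∈ I from Ideal.mem_sup_right h5)
      convert h6 using 1
      have h7 : ∀ i, eval p (pderiv i (complexify f)) = (N i : ℂ) := fun i => by
        rw [complexify, pderiv_map, hN]
        exact eval_complexify _ v
      have h8 : eval p (complexify f) = 0 := by
        have := eval_complexify f v
        rw [hfv] at this
        simpa using this
      simp only [h7, h8, linearFormAt]
      simp [hp]
    -- The frame identity expresses each coordinate function through the linear forms of `v`, `N`
    -- and `u`.
    have h9 : C (K : ℂ) * (X i - C (p i)) = C (v i * A : ℂ) * linearFormAt v v +
        C (N i * B : ℂ) * linearFormAt N v + C (u i : ℂ) * linearFormAt u v := by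
      have h10 : ∀ j, (C (v i * A : ℂ) * C (v j : ℂ) + C (N i * B : ℂ) * C (N j : ℂ) +
          C (u i : ℂ) * C (u j : ℂ) : MvPolynomial (Fin 3) ℂ) =
          if i = j then C (K : ℂ) else 0 := fun j => by
        have h12 : (v i * A * v j + N i * B * N j + u i * u j : ℂ) =
            ((if i = j then K else 0 : ℝ) : ℂ) := by
          rw [← hframe i j]; push_cast; ring
        simp only [← C_mul, ← C_add]
        rw [h12]
        split_ifs <;> simp
      calc C (K : ℂ) * (X i - C (p i)) =
            ∑ j, (if i = j then C (K : ℂ) else 0) * (X j - C (p j)) := by simp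
        _ = _ := by
            simp only [← h10, linearFormAt, Finset.mul_sum, ← Finset.sum_add_distrib]
            exact Finset.sum_congr rfl fun j _ => by ring
    have h11 : X i - C (p i) = C (K : ℂ)⁻¹ * (C (K : ℂ) * (X i - C (p i))) := by
      rw [← mul_assoc, ← C_mul, inv_mul_cancel₀ (Complex.ofReal_ne_zero.2 hK), C_1, one_mul]
    change X i - C (p i) ∈ I
    rw [h11, h9]
    exact I.mul_mem_left _ (I.add_mem (I.add_mem (I.mul_mem_left _ h1) (I.mul_mem_left _ h4))
      (I.mul_mem_left _ h2))
  have hmap := Ideal.map_mono (f := algebraMap _ (LocalRingAt p)) hpoly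
  rw [Ideal.map_sup, Ideal.map_sup, Ideal.map_pow, Localization.AtPrime.map_eq_maximalIdeal,
    Ideal.map_span, Ideal.map_span, Set.image_pair, Set.image_singleton, pow_two] at hmap
  -- Nakayama's lemma removes the square of the maximal ideal.
  refine Submodule.le_of_le_smul_of_le_jacobson_bot (IsNoetherian.noetherian _)
    (IsLocalRing.jacobson_eq_maximalIdeal _ bot_ne_top).ge hmap

/-- The local algebra of a curve at a smooth real point is as in
`exists_unit_mul_pow_of_rank_quotient`. -/
lemma exists_unit_of_rank {f g : MvPolynomial (Fin 3) ℝ} {v u : Fin 3 → ℝ}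
    (hfv : eval v f = 0) {N : Fin 3 → ℝ} (hN : ∀ i, N i = eval v (pderiv i f))
    {A B K : ℝ} (hK : K ≠ 0)
    (hframe : ∀ i j, v i * v j * A + N i * N j * B + u i * u j = if i = j then K else 0)
    (hnil : ∀ k, algebraMap _ (LocalRingAt fun i => (v i : ℂ)) (linearFormAt u v ^ k) ∉
      Ideal.span {algebraMap _ (LocalRingAt fun i => (v i : ℂ)) (complexify f),
        algebraMap _ _ (linearFormAt v v)}) {n : ℕ}
    (hn : Cardinal.toENat (Module.rank ℂ (LocalRingAt (fun i => (v i : ℂ)) ⧸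
      intersectionIdeal (complexify f) (complexify g) fun i => (v i : ℂ))) = n) :
    ∃ r : LocalRingAt fun i => (v i : ℂ), IsUnit r ∧
      algebraMap _ _ (complexify g) - r * algebraMap _ _ (linearFormAt u v ^ n) ∈
        Ideal.span {algebraMap _ (LocalRingAt fun i => (v i : ℂ)) (complexify f),
          algebraMap _ _ (linearFormAt v v)} := by
  have hmax := maximalIdeal_le hfv hN hK hframe
  have hI : intersectionIdeal (complexify f) (complexify g) (fun i => (v i : ℂ)) =
      Ideal.span {algebraMap _ (LocalRingAt fun i => (v i : ℂ)) (complexify f),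
        algebraMap _ _ (linearFormAt v v)} ⊔
      Ideal.span {algebraMap _ (LocalRingAt fun i => (v i : ℂ)) (complexify g)} := by
    rw [intersectionIdeal, chartEquation_ofReal]
    simp only [Ideal.span_insert]
    rw [sup_assoc, sup_comm (Ideal.span {algebraMap _ _ (linearFormAt v v)})]
  rw [hI] at hn
  have hm : ∀ F : MvPolynomial (Fin 3) ℂ, eval (fun i => (v i : ℂ)) F = 0 →
      algebraMap _ (LocalRingAt fun i => (v i : ℂ)) F ∈ IsLocalRing.maximalIdeal _ := by
    intro F hF
    rw [← Localization.AtPrime.map_eq_maximalIdeal]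
    exact Ideal.mem_map_of_mem _ hF
  have hl : ∀ w : Fin 3 → ℝ, eval (fun i => (v i : ℂ)) (linearFormAt w v) = 0 := fun w => by
    simp [linearFormAt]
  simp only [map_pow] at hnil ⊢
  refine exists_unit_sub_mem_of_rank_quotient ?_ (hm _ (hl u)) hmax (fun x => ?_) hnil hn
  · rw [Ideal.span_le]
    rintro _ (rfl | rfl)
    · refine hm _ ?_
      rw [eval_complexify, hfv, Complex.ofReal_zero]
    · exact hm _ (hl v)
  · obtain ⟨⟨a, s⟩, has⟩ := IsLocalization.surj (pointIdeal fun i => (v i : ℂ)).primeCompl x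
    have hs : eval (fun i => (v i : ℂ)) (s : MvPolynomial (Fin 3) ℂ) ≠ 0 := s.2
    set c := eval (fun i => (v i : ℂ)) a / eval (fun i => (v i : ℂ)) (s : MvPolynomial (Fin 3) ℂ)
      with hc
    refine ⟨c, ?_⟩
    have h1 := hm (a - C c * (s : MvPolynomial (Fin 3) ℂ)) (by simp [hc, hs])
    have h2 : (x - algebraMap ℂ _ c) * algebraMap _ _ (s : MvPolynomial (Fin 3) ℂ) =
        algebraMap _ (LocalRingAt fun i => (v i : ℂ)) (a - C c * (s : MvPolynomial (Fin 3) ℂ)) := by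
      rw [sub_mul, has, map_sub, map_mul]
      rfl
    rw [← h2] at h1
    exact ((IsLocalRing.maximalIdeal.isMaximal _).isPrime.mem_or_mem h1).resolve_right
      fun h => h (IsLocalization.map_units _ s)

end Branch

/-! ### Parity of the multiplicity from the sign of `g` -/

section Parity

/-- If `f` vanishes to first order at the real point `v` and `g` has constant sign on the real curve
near `v`, then the intersection multiplicity is even. -/
lemma even_of_sign {f g a : MvPolynomial (Fin 3) ℝ} {v : Fin 3 → ℝ} (hv : v ≠ 0) {m : ℕ}
    (hf : f.IsHomogeneous m) (hfv : eval v f = 0) (hN : ∃ i, eval v (pderiv i f) ≠ 0)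
    (ha : eval v a ≠ 0) (hsign : ∀ q, eval q f = 0 → 0 ≤ eval q a * eval q g) {n : ℕ}
    (hn : Cardinal.toENat (Module.rank ℂ (LocalRingAt (fun i => (v i : ℂ)) ⧸
      intersectionIdeal (complexify f) (complexify g) fun i => (v i : ℂ))) = n) : Even n := by
  obtain ⟨N, hN'⟩ : ∃ N : Fin 3 → ℝ, ∀ i, N i = eval v (pderiv i f) := ⟨_, fun _ => rfl⟩
  have hN0 : N ≠ 0 := by
    obtain ⟨i, hi⟩ := hN
    exact fun h => hi (by rw [← hN', h]; rfl)
  -- Euler's identity: the gradient at a zero of a form is orthogonal to the point.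
  have hvN : ∑ i, v i * N i = 0 := by
    have h1 := congrArg (eval v) hf.sum_X_mul_pderiv
    simpa [hfv, ← hN'] using h1
  obtain ⟨hv2, hN2, u, hu2, hvu, huN, hframe⟩ := exists_orthogonal_frame hv hN0 hvN
  have hDN : 0 < eval v (directionalDeriv N f) := by
    rw [eval_directionalDeriv]
    simpa only [← hN', ← pow_two] using hN2
  -- For `w ⟂ v` the points `v + x.1 N + x.2 w` stay in the chart plane, so a congruence modulo `f`
  -- and the chart equation becomes an identity of values at real curve points.
  have key : ∀ {G Q : MvPolynomial (Fin 3) ℂ}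
      {r : LocalRingAt fun i => (v i : ℂ)},
      algebraMap _ (LocalRingAt fun i => (v i : ℂ)) G - r * algebraMap _ _ Q ∈
      Ideal.span {algebraMap _ (LocalRingAt fun i => (v i : ℂ)) (complexify f),
        algebraMap _ _ (linearFormAt v v)} →
      ∃ D M : MvPolynomial (Fin 3) ℂ, eval (fun i => (v i : ℂ)) D ≠ 0 ∧
        (IsUnit r → eval (fun i => (v i : ℂ)) M ≠ 0) ∧
        ∀ w : Fin 3 → ℝ, ∑ i, v i * w i = 0 → ∀ x : ℝ × ℝ,
          eval (fun i => v i + x.1 * N i + x.2 * w i) f = 0 →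
          eval (fun i => ((v i + x.1 * N i + x.2 * w i : ℝ) : ℂ)) D *
            eval (fun i => ((v i + x.1 * N i + x.2 * w i : ℝ) : ℂ)) G =
          eval (fun i => ((v i + x.1 * N i + x.2 * w i : ℝ) : ℂ)) M *
            eval (fun i => ((v i + x.1 * N i + x.2 * w i : ℝ) : ℂ)) Q := by
    intro G Q r h
    obtain ⟨D, M, hD, hM, hDM⟩ := exists_eval_mul_eq h
    refine ⟨D, M, hD, hM, fun w hw x hx => hDM _ ?_ ?_⟩
    · rw [eval_complexify, hx, Complex.ofReal_zero]
    · simp only [add_assoc]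
      rw [eval_linearFormAt, Complex.ofReal_eq_zero]
      simp only [mul_add, Finset.sum_add_distrib, mul_left_comm (v _), ← Finset.mul_sum, hvN, hw,
        mul_zero, add_zero]
  have hlin : ∀ (w : Fin 3 → ℝ) (x : ℝ × ℝ),
      eval (fun i => ((v i + x.1 * N i + x.2 * w i : ℝ) : ℂ)) (linearFormAt u v) =
        ((x.2 * ∑ i, u i * w i : ℝ) : ℂ) := by
    intro w x
    simp only [add_assoc]
    rw [eval_linearFormAt]
    congr 1
    simp only [mul_add, Finset.sum_add_distrib, mul_left_comm (u _), ← Finset.mul_sum, huN,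
      mul_zero, zero_add]
  have hcont : ∀ (w : Fin 3 → ℝ) (G : MvPolynomial (Fin 3) ℂ), Filter.Tendsto
      (fun x : ℝ × ℝ => eval (fun i => ((v i + x.1 * N i + x.2 * w i : ℝ) : ℂ)) G) (nhds 0)
      (nhds (eval (fun i => (v i : ℂ)) G)) := by
    intro w G
    have h1 : Continuous fun x : ℝ × ℝ =>
        eval (fun i => ((v i + x.1 * N i + x.2 * w i : ℝ) : ℂ)) G :=
      (continuous_eval G).comp (by fun_prop)
    simpa using h1.tendsto 0
  have huu : ∑ i, u i * u i = ∑ i, u i ^ 2 := by simp only [pow_two]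
  -- Arbitrarily close to `v` there are real curve points with `x.2 > 0`, where the uniformizer
  -- takes the nonzero value `x.2 * |u|²`; none of its powers can vanish on the curve.
  have hnil : ∀ k, algebraMap _ (LocalRingAt fun i => (v i : ℂ)) (linearFormAt u v ^ k) ∉
      Ideal.span {algebraMap _ (LocalRingAt fun i => (v i : ℂ)) (complexify f),
        algebraMap _ _ (linearFormAt v v)} := by
    intro k hk
    obtain ⟨D, M, hD, -, hDM⟩ := key (G := linearFormAt u v ^ k) (Q := 0) (r := 0)
      (by simpa using hk)
    obtain ⟨x, ⟨hx, hx2⟩, hxD⟩ :=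
      ((frequently_zero_pos hfv hDN u).and_eventually ((hcont u D).eventually_ne hD)).exists
    have h1 := hDM u hvu x hx
    rw [map_zero, mul_zero, map_pow, hlin, huu] at h1
    refine mul_ne_zero hxD (pow_ne_zero _ (Complex.ofReal_ne_zero.2 ?_)) h1
    exact (mul_pos hx2 hu2).ne'
  obtain ⟨r, hr, hg⟩ := exists_unit_of_rank hfv hN' (mul_pos hv2 hN2).ne' hframe hnil hn
  obtain ⟨D, M, hD, hM, hDM⟩ := key hg
  replace hM := hM hr
  set L : ℂ := (eval v a : ℝ) * eval (fun i => (v i : ℂ)) M / eval (fun i => (v i : ℂ)) D with hL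
  have hL0 : L ≠ 0 := div_ne_zero (mul_ne_zero (Complex.ofReal_ne_zero.2 ha) hM) hD
  -- On the curve, `a * g / x.2 ^ n = κ ^ n * (a * M / D)`, because the uniformizer is `x.2 * κ`.
  -- The left side is real and nonnegative, and the right side tends to `κ ^ n * L`.
  have hlim : ∀ (w : Fin 3 → ℝ), ∑ i, v i * w i = 0 → ∀ κ : ℝ, ∑ i, u i * w i = κ → κ ≠ 0 →
      ((κ : ℂ) ^ n * L).im = 0 ∧ 0 ≤ ((κ : ℂ) ^ n * L).re := by
    intro w hw κ hκ hκ0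
    set F : ℝ × ℝ → ℂ := fun x => (κ : ℂ) ^ n *
      (eval (fun i => ((v i + x.1 * N i + x.2 * w i : ℝ) : ℂ)) (complexify a) *
        eval (fun i => ((v i + x.1 * N i + x.2 * w i : ℝ) : ℂ)) M /
        eval (fun i => ((v i + x.1 * N i + x.2 * w i : ℝ) : ℂ)) D) with hF
    have hFL : Filter.Tendsto F (nhds 0) (nhds ((κ : ℂ) ^ n * L)) := by
      rw [hL, ← eval_complexify]
      exact (((hcont w _).mul (hcont w M)).div (hcont w D) hD).const_mul _
    have hfreq := (frequently_zero_pos hfv hDN w).and_eventually ((hcont w D).eventually_ne hD)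
    have hval : ∃ᶠ x in nhds 0, (F x).im = 0 ∧ 0 ≤ (F x).re := by
      refine hfreq.mono fun x hx => ?_
      obtain ⟨⟨hx0, hx2⟩, hxD⟩ := hx
      have h1 := hDM w hw x hx0
      rw [map_pow, hlin, hκ, eval_complexify] at h1
      have h2 : F x = ((eval (fun i => v i + x.1 * N i + x.2 * w i) a *
          eval (fun i => v i + x.1 * N i + x.2 * w i) g / x.2 ^ n : ℝ) : ℂ) := by
        have hx2' : (x.2 : ℂ) ≠ 0 := Complex.ofReal_ne_zero.2 hx2.ne'
        simp only [hF]
        rw [eval_complexify]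
        push_cast at h1 hxD ⊢
        rw [mul_pow] at h1
        field_simp
        linear_combination -((eval (fun i => v i + x.1 * N i + x.2 * w i) a : ℝ) : ℂ) * h1
      rw [h2, Complex.ofReal_im, Complex.ofReal_re]
      exact ⟨rfl, div_nonneg (hsign _ hx0) (pow_nonneg hx2.le n)⟩
    have hclosed : IsClosed {z : ℂ | z.im = 0 ∧ 0 ≤ z.re} :=
      (isClosed_eq Complex.continuous_im continuous_const).inter
        (isClosed_le continuous_const Complex.continuous_re)
    exact hclosed.mem_of_frequently_of_tendsto hval hFL
  -- The directions `w = u` and `w = -u` approach `v` from both sides, with `κ = ±|u|²`. For odd `n`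
  -- they give opposite signs, forcing `L = 0`.
  by_contra hodd
  rw [Nat.not_even_iff_odd] at hodd
  obtain ⟨h1, h2⟩ := hlim u hvu _ huu hu2.ne'
  obtain ⟨-, h4⟩ := hlim (-u) (by simpa using hvu) (-∑ i, u i ^ 2) (by simp [huu])
    (neg_ne_zero.2 hu2.ne')
  rw [Complex.ofReal_neg, hodd.neg_pow, neg_mul, Complex.neg_re] at h4
  refine mul_ne_zero (pow_ne_zero n (Complex.ofReal_ne_zero.2 hu2.ne')) hL0 (Complex.ext ?_ ?_)
  · rw [Complex.zero_re]; linarith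
  · rw [Complex.zero_im]; exact h1

end Parity

/-! ### Complex conjugation on points and multiplicities -/

section Conjugation

lemma conjPoint_mk (v : Fin 3 → ℂ) (hv : v ≠ 0) :
    conjPoint (Projectivization.mk ℂ v hv) =
      Projectivization.mk ℂ (star v) (star_ne_zero.2 hv) := rfl

lemma conjPoint_conjPoint (P : Plane) : conjPoint (conjPoint P) = P := by
  induction P using Projectivization.ind with
  | h v hv => simp only [conjPoint_mk, star_star]

/-- Dividing by a nonzero coordinate cancels the conjugation factor `c`, so all ratios are fixed by
conjugation. -/
lemma isRealPoint_of_conjPoint_eq {P : Plane} (h : conjPoint P = P) : IsRealPoint P := by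
  induction P using Projectivization.ind with
  | h v hv =>
    rw [conjPoint_mk, Projectivization.mk_eq_mk_iff'] at h
    obtain ⟨c, hc⟩ := h
    obtain ⟨j, hj⟩ := Function.ne_iff.1 hv
    have hj : v j ≠ 0 := hj
    have hreal : ∀ i, star (v i / v j) = v i / v j := by
      intro i
      have hi : c * v i = star (v i) := congrFun hc i
      have hj' : c * v j = star (v j) := congrFun hc j
      have hc0 : c ≠ 0 := by
        rintro rfl
        rw [zero_mul] at hj'
        exact hj (star_eq_zero.1 hj'.symm)
      rw [star_div₀, ← hi, ← hj', mul_div_mul_left _ _ hc0]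
    have hre : (fun i => (((v i / v j).re : ℝ) : ℂ)) = (v j)⁻¹ • v := by
      funext i
      rw [Complex.conj_eq_iff_re.1 (hreal i)]
      simp [div_eq_inv_mul]
    have hne : (fun i => (((v i / v j).re : ℝ) : ℂ)) ≠ 0 := by
      rw [hre]; exact smul_ne_zero (inv_ne_zero hj) hv
    refine ⟨fun i => (v i / v j).re, hne, ?_⟩
    rw [Projectivization.mk_eq_mk_iff']
    exact ⟨v j, by rw [hre, smul_smul, mul_inv_cancel₀ hj, one_smul]⟩

lemma exists_rep_eq (v : Fin 3 → ℂ) (hv : v ≠ 0) :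
    ∃ c : ℂ, c ≠ 0 ∧ ∀ i, (Projectivization.mk ℂ v hv).rep i = c * v i := by
  obtain ⟨c, hc⟩ := Projectivization.exists_smul_eq_mk_rep ℂ v hv
  exact ⟨c, c.ne_zero, fun i => by rw [← hc]; rfl⟩

lemma eval_rep_eq_zero_iff {F : MvPolynomial (Fin 3) ℂ} {m : ℕ} (hF : F.IsHomogeneous m)
    (v : Fin 3 → ℂ) (hv : v ≠ 0) :
    eval (Projectivization.mk ℂ v hv).rep F = 0 ↔ eval v F = 0 := by
  obtain ⟨c, hc, h⟩ := exists_rep_eq v hv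
  have h1 := eval_twist (τ := RingEquiv.refl ℂ) hc F v
  rw [twist_of_isHomogeneous (τ := RingEquiv.refl ℂ) hc hF (map_id F)] at h1
  have h2 : (Projectivization.mk ℂ v hv).rep = fun i => c * RingEquiv.refl ℂ (v i) := funext h
  have h3 : _ = eval v F := h1
  rw [h2, ← h3, map_mul, eval_C, mul_eq_zero,
    or_iff_right (pow_ne_zero _ (inv_ne_zero hc))]

lemma map_conj_complexify (f : MvPolynomial (Fin 3) ℝ) :
    map ((starRingAut : ℂ ≃+* ℂ) : ℂ →+* ℂ) (complexify f) = complexify f := by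
  have h : ((starRingAut : ℂ ≃+* ℂ) : ℂ →+* ℂ).comp (algebraMap ℝ ℂ) = algebraMap ℝ ℂ := by
    ext r
    simp
  rw [complexify, map_map, h]

lemma intersectionMultiplicity_conjPoint {f g : MvPolynomial (Fin 3) ℝ} {m n : ℕ}
    (hf : f.IsHomogeneous m) (hg : g.IsHomogeneous n) (P : Plane) :
    intersectionMultiplicity (complexify f) (complexify g) (conjPoint P) =
      intersectionMultiplicity (complexify f) (complexify g) P := by
  have h : conjPoint P = Projectivization.mk ℂ (star P.rep) (star_ne_zero.2 P.rep_nonzero) := by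
    conv_lhs => rw [← P.mk_rep]
    rfl
  obtain ⟨c, hc, hrep⟩ := exists_rep_eq (star P.rep) (star_ne_zero.2 P.rep_nonzero)
  rw [← h] at hrep
  unfold intersectionMultiplicity
  rw [rank_quotient_intersectionIdeal_twist (τ := starRingAut) (fun _ => rfl) (hf.map _)
    (hg.map _) (map_conj_complexify f) (map_conj_complexify g) hc hrep]

lemma intersectionMultiplicity_mk {f g : MvPolynomial (Fin 3) ℂ} {m n : ℕ}
    (hf : f.IsHomogeneous m) (hg : g.IsHomogeneous n) (v : Fin 3 → ℂ) (hv : v ≠ 0) :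
    intersectionMultiplicity f g (Projectivization.mk ℂ v hv) =
      Cardinal.toENat (Module.rank ℂ (LocalRingAt v ⧸ intersectionIdeal f g v)) := by
  obtain ⟨c, hc, hrep⟩ := exists_rep_eq v hv
  unfold intersectionMultiplicity
  rw [rank_quotient_intersectionIdeal_twist (τ := RingEquiv.refl ℂ) (fun _ => rfl) hf hg
    (map_id f) (map_id g) hc hrep]

lemma conjPoint_mem_complexCurve {f : MvPolynomial (Fin 3) ℝ} {m : ℕ} (hf : f.IsHomogeneous m)
    {P : Plane} (hP : P ∈ complexCurve (complexify f)) :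
    conjPoint P ∈ complexCurve (complexify f) := by
  have h : conjPoint P = Projectivization.mk ℂ (star P.rep) (star_ne_zero.2 P.rep_nonzero) := by
    conv_lhs => rw [← P.mk_rep]
    rfl
  change eval _ _ = 0
  rw [h, eval_rep_eq_zero_iff (hf.map _)]
  have h1 := eval_twist (τ := starRingAut) one_ne_zero (complexify f) P.rep
  rw [twist_of_isHomogeneous one_ne_zero (hf.map _) (map_conj_complexify f)] at h1
  have h2 : eval P.rep (complexify f) = 0 := hP
  rw [h2, map_zero, map_mul, eval_C, inv_one, one_pow, one_mul] at h1
  have h3 : star P.rep = fun i => 1 * starRingAut (P.rep i) := by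
    funext i
    simp
  rw [h3]
  exact h1

end Conjugation

/-! ### Splitting an invariant divisor -/

section Divisors

/-- A conjugation-invariant effective divisor with even multiplicities at the real points is of the
form `D + D̄`. -/
lemma exists_add_conjDivisor {S : Set Plane} (hS : S.Finite) (hconj : ∀ P ∈ S, conjPoint P ∈ S)
    (μ : Plane → ℤ) (hμ : ∀ P, μ (conjPoint P) = μ P)
    (heven : ∀ P ∈ S, conjPoint P = P → Even (μ P)) :
    ∃ D : Plane →₀ ℤ, (∀ P ∉ S, D P = 0) ∧ ∀ P, (D + conjDivisor D) P = S.indicator μ P := by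
  classical
  have hconj' : ∀ P, conjPoint P ∈ S ↔ P ∈ S := fun P =>
    ⟨fun h => conjPoint_conjPoint P ▸ hconj _ h, hconj P⟩
  have hinj : Function.Injective conjPoint :=
    (show Function.Involutive conjPoint from conjPoint_conjPoint).injective
  -- Half the multiplicity at self-conjugate points; a well-ordering selects which point of each
  -- conjugate pair carries the full multiplicity.
  let F : Plane → ℤ := S.indicator fun P =>
    if conjPoint P = P then μ P / 2 else if WellOrderingRel P (conjPoint P) then μ P else 0
  let D : Plane →₀ ℤ := Finsupp.onFinset hS.toFinset F fun P hP => by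
    rw [Set.Finite.mem_toFinset]
    by_contra h
    exact hP (Set.indicator_of_notMem h _)
  have hD : ∀ P, D P = F P := fun P => rfl
  refine ⟨D, fun P hP => (hD P).trans (Set.indicator_of_notMem hP _), fun P => ?_⟩
  have h1 : conjDivisor D P = F (conjPoint P) := by
    conv_lhs => rw [← conjPoint_conjPoint P]
    rw [conjDivisor, Finsupp.mapDomain_apply hinj, hD]
  rw [Finsupp.add_apply, h1, hD]
  by_cases hP : P ∈ S
  · simp only [F, Set.indicator_of_mem hP, Set.indicator_of_mem ((hconj' P).2 hP),
      conjPoint_conjPoint, hμ]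
    by_cases hreal : conjPoint P = P
    · obtain ⟨k, hk⟩ := heven P hP hreal
      simp only [hreal, if_true]
      omega
    · have hreal' : ¬ P = conjPoint P := fun h => hreal h.symm
      simp only [if_neg hreal, if_neg hreal']
      rcases trichotomous_of WellOrderingRel P (conjPoint P) with h | h | h
      · rw [if_pos h, if_neg (asymm h), add_zero]
      · exact absurd h.symm hreal
      · rw [if_neg (asymm h), if_pos h, zero_add]
  · simp only [F, Set.indicator_of_notMem hP, Set.indicator_of_notMem (fun h => hP ((hconj' P).1 h)),
      add_zero]

end Divisors

/-! ### Assembly -/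

section Main

lemma even_intersectionMultiplicity {f g : MvPolynomial (Fin 3) ℝ} {e : Fin 3 → ℝ}
    (hfe : eval e f ≠ 0)
    (hsing : ∀ P ∈ singularPoints (complexify f), ¬ IsRealPoint P) (hg : Interlaces g f e)
    {P : Plane} (hP : P ∈ complexCurve (complexify f)) (hreal : IsRealPoint P) {n : ℕ}
    (hn : intersectionMultiplicity (complexify f) (complexify g) P = n) : Even n := by
  obtain ⟨d, hfd, hgd, hge, -⟩ := hg.exists_roots hfe
  obtain ⟨v, hv, rfl⟩ := id hreal
  have hv0 : v ≠ 0 := by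
    rintro rfl
    exact hv (by ext; simp)
  have hiff : ∀ {F : MvPolynomial (Fin 3) ℝ} {m : ℕ}, F.IsHomogeneous m →
      (eval (Projectivization.mk ℂ (fun i => (v i : ℂ)) hv).rep (complexify F) = 0 ↔
        eval v F = 0) := fun {F m} hF => by
    rw [eval_rep_eq_zero_iff (hF.map _), eval_complexify, Complex.ofReal_eq_zero]
  have hfv : eval v f = 0 := (hiff hfd).1 hP
  have hgrad : ∃ i, eval v (pderiv i f) ≠ 0 := by
    by_contra! h
    refine hsing _ ⟨hP, fun i => ?_⟩ hreal
    rw [complexify, pderiv_map]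
    exact (hiff hfd.pderiv).2 (h i)
  have hDe : eval v (directionalDeriv e f) ≠ 0 := by
    intro h
    obtain ⟨i, hi⟩ := hgrad
    have := hg.directionalDeriv_eq_zero hfe hfv h (Pi.single i 1)
    rw [eval_directionalDeriv] at this
    simp [Pi.single_apply] at this
    exact hi this
  rw [intersectionMultiplicity_mk (hfd.map _) (hgd.map _)] at hn
  -- The auxiliary form is `D_e f`, nonzero at `v`; the constant `f(e) g(e)` normalizes the sign of
  -- its product with `g`.
  refine even_of_sign (a := C (eval e f * eval e g) * directionalDeriv e f) hv0 hfd hfv hgrad ?_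
    (fun q hq => ?_) hn
  · rw [map_mul, eval_C]
    exact mul_ne_zero (mul_ne_zero hfe hge) hDe
  · rw [map_mul, eval_C, mul_assoc]
    exact hg.sign hfe hq

lemma isCurveOfRealContact {f g : MvPolynomial (Fin 3) ℝ} {e : Fin 3 → ℝ} (hfe : eval e f ≠ 0)
    (hsing : ∀ P ∈ singularPoints (complexify f), ¬ IsRealPoint P) (hg : Interlaces g f e)
    (hfg : IsRelPrime f g) : IsCurveOfRealContact f g := by
  obtain ⟨d, hfd, hgd, -, -⟩ := hg.exists_roots hfe
  have hf0 : f ≠ 0 := by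
    rintro rfl
    exact hfe (map_zero _)
  have hfin : ∀ P : Plane, ∃ n : ℕ,
      intersectionMultiplicity (complexify f) (complexify g) P = n := fun P => by
    have := finite_quotient_intersectionIdeal hfd hgd hfg hf0 P.rep_nonzero
    exact ⟨_, by rw [intersectionMultiplicity, ← Module.finrank_eq_rank, Cardinal.toENat_nat]⟩
  choose μ hμ using hfin
  obtain ⟨D, hD0, hD⟩ := exists_add_conjDivisor (finite_commonZeros hfd hgd hfg hf0)
    (fun P hP => ⟨conjPoint_mem_complexCurve hfd hP.1, conjPoint_mem_complexCurve hgd hP.2⟩)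
    (fun P => (μ P : ℤ))
    (fun P => by
      have h := intersectionMultiplicity_conjPoint hfd hgd P
      rw [hμ, hμ] at h
      exact_mod_cast h)
    (fun P hP hreal => by
      have := even_intersectionMultiplicity hfe hsing hg hP.1
        (isRealPoint_of_conjPoint_eq hreal) (hμ P)
      exact_mod_cast this)
  refine ⟨D, ?_, fun P hP => ⟨μ P, hμ P, ?_⟩, fun P hP => ?_⟩
  · rw [divisorsOn, Finsupp.mem_supported]
    intro P hP
    by_contra h
    exact Finsupp.mem_support_iff.1 hP (hD0 P fun hP' => h hP'.1)
  · rw [hD, Set.indicator_of_mem hP]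
  · rw [hD, Set.indicator_of_notMem hP]

end Main

end

end RealContact

theorem mainTheorem7
    (f g : MvPolynomial (Fin 3) ℝ) (e : Fin 3 → ℝ)
    (hf : RealContact.IsHyperbolic f e)
    (hsing : ∀ P ∈ RealContact.singularPoints (RealContact.complexify f),
      ¬ RealContact.IsRealPoint P)
    (hg : RealContact.Interlaces g f e) :
    (IsRelPrime f g → RealContact.IsCurveOfRealContact f g) ∧
    ∀ P ∈ RealContact.complexCurve (RealContact.complexify f) ∩
        RealContact.complexCurve (RealContact.complexify g),
      RealContact.IsRealPoint P →
      ∀ n : ℕ, RealContact.intersectionMultiplicity (RealContact.complexify f)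
        (RealContact.complexify g) P = n → Even n :=
  ⟨RealContact.isCurveOfRealContact hf.2.1 hsing hg, fun _ hP hreal _ hn =>
    RealContact.even_intersectionMultiplicity hf.2.1 hsing hg hP.1 hreal hn⟩
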